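/- Let $\alpha_t,\alpha_e\ge 0$, $\alpha_s>0$, $\gamma_t,\gamma_s,\gamma_e>0$, and put $\alpha=\alpha_e+\alpha_s(\alpha_t-\tfrac12)$, $\nu_s=\alpha-1$. On $\mathbb R^2\times\mathbb R$ let $L=\gamma_s^2-\Delta$ act in space, let $\mathcal E_Q$ be centred Gaussian noise that is white in time and has precision operator $Q=\gamma_e^2L^{\alpha_e}$ in space (a centred Gaussian family indexed by Schwartz functions with $\mathrm{Cov}(\mathcal E_Q(\varphi),\mathcal E_Q(\psi))=\int\varphi\,Q^{-1}\psi$), and let $u$ be the solution (as a generalized random field on Schwartz functions) of $$\Bigl(\gamma_t\frac{\partial}{\partial t}+L^{\alpha_s/2}\Bigr)^{\alpha_t}u=\mathcal E_Q ,$$ where the operators are Fourier multipliers. Assume $\alpha>1$. Then $u$ has a space-time spectral density $S_u(\omega_s,\omega_t)$ whose marginal temporal spectrum $S_t(\omega_t)=\int_{\mathbb R^2}S_u(\omega_s,\omega_t)\,d\omega_s$ is, for some constant $C>0$ and all $\omega_t\in\mathbb R$, $$S_t(\omega_t)=C\;{}_2F_1\!\Bigl(\alpha_t,\ \tfrac{\alpha_e-1}{\alpha_s}+\alpha_t;\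 \tfrac{\alpha_e-1}{\alpha_s}+\alpha_t+1;\ -\gamma_t^2\gamma_s^{-2\alpha_s}\omega_t^2\Bigr),$$ where ${}_2F_1$ is Gauss' hypergeometric function, continued analytically to $\mathbb C\setminus[1,\infty)$. Moreover, if $u$ is given by a mean-square continuous random field $u(s,t)$ (square integrable at every point, with $u(\varphi)=\int\varphi(s,t)\,u(s,t)\,d(s,t)$ in $L^2$), then for every $s\in\mathbb R^2$ the process $t\mapsto u(s,t)$ has spectral density $S_t$, that is, $S_t$ is integrable and $\mathrm{Cov}(u(s,t_1),u(s,t_2))=\int_{\mathbb R}e^{i\omega(t_1-t_2)}S_t(\omega)\,d\omega$, and its mean-square smoothness is $$\nu_t=\min\Bigl[\alpha_t-\tfrac12,\ \frac{\nu_s}{\alpha_s}\Bigr]\ (\ge 0):$$ the process is $\nu$ times mean-square differentiable for every $0\le\nu<\nu_t$ and for no $\nu>\nu_t$. Here $\nu$ times mean-square differentiable means that the process, as a curve in $L^2$, is $\lfloor\nu\rfloor$ times continuously differentiable and its derivative of order $\lfloor\nu\rfloor$ is locally Hölder continuous with exponent $\nu-\lfloor\nu\rfloor$. -/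

import Mathlib

open MeasureTheory ProbabilityTheory
open scoped FourierTransform SchwartzMap ENNReal NNReal Topology

noncomputable section

namespace DEMF

/-- The spatial domain `ℝ²`, with its Euclidean norm. -/
abbrev Space : Type := EuclideanSpace ℝ (Fin 2)

/-- Space-time `ℝ² × ℝ` with its Euclidean inner product and Lebesgue measure:
`x.fst` is the spatial and `x.snd` the temporal coordinate. -/
abbrev SpaceTime : Type := WithLp 2 (Space × ℝ)

/-! ### Gauss' hypergeometric function -/

/-- `F` is the principal branch of `₂F₁(a, b; c; ·)`: it is holomorphic on `ℂ ∖ [1, ∞)` and is the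
sum of the Gauss series on the open unit disc. There is at most one such `F` on `ℂ ∖ [1, ∞)`. -/
def IsGaussHypergeometric (a b c : ℂ) (F : ℂ → ℂ) : Prop :=
  DifferentiableOn ℂ F {z | 1 - z ∈ Complex.slitPlane} ∧
    ∀ z : ℂ, ‖z‖ < 1 → F z = ordinaryHypergeometric a b c z

open Classical in
/-- Gauss' hypergeometric function `₂F₁(a, b; c; z)` for `z ∈ ℂ ∖ [1, ∞)`, the analytic
continuation of the hypergeometric series. (Mathlib's `ordinaryHypergeometric` is the sum of the
series, and so is meaningful on the unit disc only.) -/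
def gaussHypergeometric (a b c : ℂ) : ℂ → ℂ :=
  if h : ∃ F, IsGaussHypergeometric a b c F then h.choose else 0

/-! ### The equation -/

/-- The translation-invariant operator with symbol `m` (a function of the angular frequency `ω`),
applied to `φ`: it multiplies the Fourier transform of `φ` by `m`. Mathlib's Fourier transform uses
the frequency `ξ = ω / 2π`. The real part is taken only to land in `ℝ`: for the symbols used below,
`m (-ω)` is the conjugate of `m ω`, and the value is real. -/
def multiplierOp (m : SpaceTime → ℂ) (φ : SpaceTime → ℝ) : SpaceTime → ℝ := fun x =>
  (𝓕⁻ (fun ξ : SpaceTime =>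
    m ((2 * Real.pi) • ξ) * 𝓕 (fun y : SpaceTime => (φ y : ℂ)) ξ) x).re

/-- Symbol of `(γₜ ∂ₜ + L^(αₛ/2))^αₜ`, where `L = γₛ² - Δ` acts in space. The base of the outer
power has positive real part when `γₛ ≠ 0`, and the power is the principal one. -/
def evolutionSymbol (αt αs γt γs : ℝ) (ω : SpaceTime) : ℂ :=
  (Complex.I * (γt * ω.snd : ℝ) + ((γs ^ 2 + ‖ω.fst‖ ^ 2) ^ (αs / 2) : ℝ)) ^ (αt : ℂ)

/-- Symbol of the precision operator `Q = γₑ² L^αₑ`, where `L = γₛ² - Δ` acts in space. -/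
def precisionSymbol (αe γs γe : ℝ) (ω : SpaceTime) : ℝ :=
  γe ^ 2 * (γs ^ 2 + ‖ω.fst‖ ^ 2) ^ αe

variable {Ω : Type*} [MeasurableSpace Ω]

/-- `W` is Gaussian noise on `ℝ² × ℝ` that is white in time and has precision operator
`Q = γₑ² L^αₑ` in space: a centred Gaussian family indexed by test functions, with
`Cov(W φ, W ψ) = ∫ φ Q⁻¹ψ`. -/
structure IsNoise (αe γs γe : ℝ) (P : Measure Ω) (W : 𝓢(SpaceTime, ℝ) → Ω → ℝ) : Prop where
  gaussian : IsGaussianProcess W P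
  centred : ∀ φ, ∫ w, W φ w ∂P = 0
  covariance_eq : ∀ φ ψ : 𝓢(SpaceTime, ℝ), cov[W φ, W ψ; P] =
    ∫ x, φ x * multiplierOp (fun ω => ((precisionSymbol αe γs γe ω)⁻¹ : ℝ)) ψ x

/-- The generalized random field `u` solves `(γₜ ∂ₜ + L^(αₛ/2))^αₜ u = W` weakly: whenever the test
function `φ` is the transposed operator (with symbol `σ(-ω)`) applied to the test function `ψ`, then
`⟨u, φ⟩ = ⟨W, ψ⟩` almost surely. -/
def IsSolution (αt αs γt γs : ℝ) (P : Measure Ω) (W u : 𝓢(SpaceTime, ℝ) → Ω → ℝ) : Prop :=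
  ∀ φ ψ : 𝓢(SpaceTime, ℝ),
    (∀ x, φ x = multiplierOp (fun ω => evolutionSymbol αt αs γt γs (-ω)) ψ x) → u φ =ᵐ[P] W ψ

/-- The random field `U s t` is the pointwise, mean-square continuous version of the generalized
random field `u`: `⟨u, φ⟩ = ∫ φ(s, t) U(s, t) d(s, t)` for all test functions, as an integral of
functions with values in `L²(P)`. -/
structure IsPointwiseVersion (P : Measure Ω) (u : 𝓢(SpaceTime, ℝ) → Ω → ℝ)
    (U : Space → ℝ → Ω → ℝ) : Prop where
  memLp : ∀ s t, MemLp (U s t) 2 P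
  continuous : Continuous fun x : SpaceTime => (memLp x.fst x.snd).toLp (U x.fst x.snd)
  integrable : ∀ φ : 𝓢(SpaceTime, ℝ),
    Integrable fun x : SpaceTime => φ x • (memLp x.fst x.snd).toLp (U x.fst x.snd)
  eq_integral : ∀ φ : 𝓢(SpaceTime, ℝ), u φ =ᵐ[P]
    ((∫ x : SpaceTime, φ x • (memLp x.fst x.snd).toLp (U x.fst x.snd) : Lp ℝ 2 P) : Ω → ℝ)

/-! ### Spectra -/

/-- The Fourier transform `∫ φ(x) exp(-i⟨ω, x⟩) dx` at the angular frequency `ω`. -/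
def angularFourier (φ : SpaceTime → ℝ) (ω : SpaceTime) : ℂ :=
  𝓕 (fun y : SpaceTime => (φ y : ℂ)) ((2 * Real.pi)⁻¹ • ω)

/-- `S` is a spectral density (in angular frequency) of the generalized random field `u`, that is,
formally `Cov(u(x), u(y)) = ∫ exp(i⟨ω, x - y⟩) S(ω) dω`. -/
structure IsSpectrum (P : Measure Ω) (u : 𝓢(SpaceTime, ℝ) → Ω → ℝ) (S : SpaceTime → ℝ) :
    Prop where
  nonneg : ∀ ω, 0 ≤ S ω
  measurable : Measurable S
  memLp : ∀ φ, MemLp (u φ) 2 P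
  integrable : ∀ φ ψ : 𝓢(SpaceTime, ℝ), Integrable fun ω : SpaceTime =>
    (starRingEnd ℂ) (angularFourier φ ω) * angularFourier ψ ω * (S ω : ℂ)
  covariance_eq : ∀ φ ψ : 𝓢(SpaceTime, ℝ), ((cov[u φ, u ψ; P] : ℝ) : ℂ) =
    ∫ ω : SpaceTime, (starRingEnd ℂ) (angularFourier φ ω) * angularFourier ψ ω * (S ω : ℂ)

/-- `St` is the marginal temporal spectrum of `u`: the space-time spectral density of `u` with the
spatial frequency integrated out. -/
def IsMarginalTemporalSpectrum (P : Measure Ω) (u : 𝓢(SpaceTime, ℝ) → Ω → ℝ) (St : ℝ → ℝ) : Prop :=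
  ∃ S : SpaceTime → ℝ, IsSpectrum P u S ∧ ∀ ωt : ℝ,
    Integrable (fun ωs : Space => S (WithLp.toLp 2 (ωs, ωt))) ∧
      St ωt = ∫ ωs : Space, S (WithLp.toLp 2 (ωs, ωt))

/-- `S` is a spectral density of the real process `X`:
`Cov(X(t₁), X(t₂)) = ∫ exp(iω(t₁ - t₂)) S(ω) dω`. -/
structure IsProcessSpectrum (P : Measure Ω) (X : ℝ → Ω → ℝ) (S : ℝ → ℝ) : Prop where
  nonneg : ∀ ω, 0 ≤ S ω
  integrable : Integrable S
  covariance_eq : ∀ t₁ t₂ : ℝ, ((cov[X t₁, X t₂; P] : ℝ) : ℂ) =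
    ∫ ω : ℝ, Complex.exp (Complex.I * (ω * (t₁ - t₂) : ℝ)) * (S ω : ℂ)

/-! ### Mean-square smoothness -/

/-- The process `X` is `ν ≥ 0` times mean-square differentiable: as a curve in `L²(P)` it is `⌊ν⌋`
times continuously differentiable, with a derivative of order `⌊ν⌋` that is locally Hölder
continuous with exponent `ν - ⌊ν⌋` (no condition beyond continuity when `ν` is an integer). -/
def IsMSDifferentiable (P : Measure Ω) (X : ℝ → Ω → ℝ) (ν : ℝ) : Prop :=
  ∃ hX : ∀ t, MemLp (X t) 2 P,
    ContDiff ℝ (⌊ν⌋₊ : ℕ) (fun t => (hX t).toLp (X t)) ∧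
      ∀ t : ℝ, ∃ C : ℝ≥0, ∃ N ∈ 𝓝 t,
        HolderOnWith C (ν - ⌊ν⌋₊).toNNReal
          (iteratedDeriv ⌊ν⌋₊ fun r => (hX r).toLp (X r)) N

/-- The mean-square smoothness of `X` is `ν₀`: `X` is `ν` times mean-square differentiable for every
`0 ≤ ν < ν₀` and for no `ν > ν₀`. -/
def HasMSSmoothness (P : Measure Ω) (X : ℝ → Ω → ℝ) (ν₀ : ℝ) : Prop :=
  0 ≤ ν₀ ∧ (∀ ν : ℝ, 0 ≤ ν → ν < ν₀ → IsMSDifferentiable P X ν) ∧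
    ∀ ν : ℝ, ν₀ < ν → ¬ IsMSDifferentiable P X ν

end DEMF

end

/-!
Passing to Fourier space, `u` has spectral density `(2π)⁻³ |σ|⁻² Q⁻¹`, with `σ` the symbol of the
evolution operator: every test function is the transposed operator applied to another one, because
powers of a symbol bounded away from the negative real axis have temperate growth. In polar
coordinates its integral over the spatial frequencies becomes, after a substitution, Euler's
integral for `₂F₁(a, b; b + 1; -x)`, where `a = αₜ`, `b = (αₑ - 1) / αₛ + αₜ` and `x` is
proportional to `ωₜ²`.

Testing `u` against mollifiers turns the covariance of the generalized field into that of its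
pointwise version. Thus `t ↦ U(s, t)` is a curve in `L²` that corresponds isometrically to the
oscillations `exp(iωt)` in `L²(Sₜ)`, and a finite moment of order `2ν` of `Sₜ` gives smoothness
`ν`. Conversely, smoothness `n + θ` makes the forward differences of order `n + 1` and step `h` of
size `O(h^(n + θ))`, whereas the frequencies of order `1 / h` alone contribute to their squared
norm at least a multiple of `h^(2m - 1)` if `Sₜ(ω)` is at least a multiple of `ω^(-2m)`. Euler's
integral has exactly this decay, with `m = min a b`.
-/

noncomputable section

namespace DEMF

/-! ### Powers of functions of temperate growth -/

section TemperateGrowth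

variable {δ : ℝ}

lemma isOpen_lt_re (δ : ℝ) : IsOpen {z : ℂ | δ < z.re} :=
  isOpen_lt continuous_const Complex.continuous_re

lemma mem_slitPlane_of_lt_re (hδ : 0 ≤ δ) {z : ℂ} (hz : δ < z.re) : z ∈ Complex.slitPlane :=
  Or.inl (hδ.trans_lt hz)

lemma exists_norm_cpow_le_of_lt_re (hδ : 0 < δ) (c : ℂ) :
    ∃ (k : ℕ) (C : ℝ), 0 ≤ C ∧ ∀ z : ℂ, δ < z.re → ‖z ^ c‖ ≤ C * (1 + ‖z‖) ^ k := by
  have hz_norm {z : ℂ} (hz : δ < z.re) : δ ≤ ‖z‖ := hz.le.trans (Complex.re_le_norm z)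
  have hbound (z : ℂ) : ‖z ^ c‖ ≤ Real.exp (Real.pi * |c.im|) * ‖z‖ ^ c.re := by
    have harg : -(z.arg * c.im) ≤ Real.pi * |c.im| := by
      refine (neg_le_abs _).trans ?_
      rw [abs_mul]
      gcongr
      exact Complex.abs_arg_le_pi z
    calc ‖z ^ c‖ ≤ ‖z‖ ^ c.re / Real.exp (z.arg * c.im) := Complex.norm_cpow_le z c
      _ = Real.exp (-(z.arg * c.im)) * ‖z‖ ^ c.re := by rw [Real.exp_neg]; ring
      _ ≤ _ := by gcongr
  rcases le_total 0 c.re with hc | hc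
  · refine ⟨⌈c.re⌉₊, Real.exp (Real.pi * |c.im|), by positivity, fun z _ => ?_⟩
    refine (hbound z).trans ?_
    gcongr
    calc ‖z‖ ^ c.re ≤ (1 + ‖z‖) ^ c.re := by gcongr; linarith
      _ ≤ (1 + ‖z‖) ^ ((⌈c.re⌉₊ : ℕ) : ℝ) :=
        Real.rpow_le_rpow_of_exponent_le (by linarith [norm_nonneg z]) (Nat.le_ceil c.re)
      _ = (1 + ‖z‖) ^ ⌈c.re⌉₊ := Real.rpow_natCast _ _
  · refine ⟨0, Real.exp (Real.pi * |c.im|) * δ ^ c.re, by positivity, fun z hz => ?_⟩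
    rw [pow_zero, mul_one]
    refine (hbound z).trans ?_
    gcongr 1
    exact Real.rpow_le_rpow_of_nonpos hδ (hz_norm hz) hc

lemma contDiffOn_cpow_const_of_lt_re (hδ : 0 ≤ δ) (c : ℂ) {n : WithTop ℕ∞} :
    ContDiffOn ℝ n (fun z : ℂ => z ^ c) {z | δ < z.re} := fun _ hz =>
  ((analyticAt_id.cpow analyticAt_const (mem_slitPlane_of_lt_re hδ hz)).contDiffAt.restrict_scalars
    ℝ).contDiffWithinAt

lemma eqOn_fderivWithin_cpow_const (hδ : 0 ≤ δ) (c : ℂ) :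
    Set.EqOn (fderivWithin ℝ (fun z : ℂ => z ^ c) {z | δ < z.re})
      (⇑(c • ContinuousLinearMap.mul ℝ ℂ) ∘ fun z => z ^ (c - 1)) {z | δ < z.re} := by
  intro z hz
  have hd : HasDerivAt (fun w : ℂ => w ^ c) (c * z ^ (c - 1)) z := by
    simpa using (hasDerivAt_id z).cpow_const (c := c) (mem_slitPlane_of_lt_re hδ hz)
  rw [(hd.hasFDerivAt.restrictScalars ℝ).hasFDerivWithinAt.fderivWithin
    ((isOpen_lt_re δ).uniqueDiffOn z hz)]
  ext : 1
  simp only [ContinuousLinearMap.coe_restrictScalars', ContinuousLinearMap.toSpanSingleton_apply,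
    smul_eq_mul, Function.comp_apply]
  simp [mul_left_comm, mul_comm]

lemma exists_norm_iteratedFDerivWithin_cpow_le (hδ : 0 < δ) (n : ℕ) (c : ℂ) :
    ∃ (k : ℕ) (C : ℝ), 0 ≤ C ∧ ∀ z : ℂ, δ < z.re →
      ‖iteratedFDerivWithin ℝ n (fun w : ℂ => w ^ c) {w | δ < w.re} z‖ ≤
        C * (1 + ‖z‖) ^ k := by
  induction n generalizing c with
  | zero => simpa using exists_norm_cpow_le_of_lt_re hδ c
  | succ n ih =>
    obtain ⟨k, C, hC, hbound⟩ := ih (c - 1)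
    have hopen := (isOpen_lt_re δ).uniqueDiffOn (𝕜 := ℝ)
    let L : ℂ →L[ℝ] ℂ →L[ℝ] ℂ := c • ContinuousLinearMap.mul ℝ ℂ
    refine ⟨k, ‖L‖ * C, by positivity, fun z hz => ?_⟩
    calc ‖iteratedFDerivWithin ℝ (n + 1) (fun w : ℂ => w ^ c) {w | δ < w.re} z‖
        = ‖iteratedFDerivWithin ℝ n (L ∘ fun w => w ^ (c - 1)) {w | δ < w.re} z‖ := by
          rw [← norm_iteratedFDerivWithin_fderivWithin hopen hz,
            iteratedFDerivWithin_congr (eqOn_fderivWithin_cpow_const hδ.le c) hz]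
      _ ≤ ‖L‖ * ‖iteratedFDerivWithin ℝ n (fun w => w ^ (c - 1)) {w | δ < w.re} z‖ := by
          rw [L.iteratedFDerivWithin_comp_left (contDiffOn_cpow_const_of_lt_re hδ.le _ z hz)
            hopen hz le_rfl]
          exact ContinuousLinearMap.norm_compContinuousMultilinearMap_le _ _
      _ ≤ ‖L‖ * C * (1 + ‖z‖) ^ k := by
          rw [mul_assoc]
          gcongr
          exact hbound z hz

lemma hasTemperateGrowth_cpow_const {E : Type*} [NormedAddCommGroup E] [NormedSpace ℝ E]
    {f : E → ℂ} (hf : f.HasTemperateGrowth) (hδ : 0 < δ) (hfδ : ∀ x, δ < (f x).re) (c : ℂ) :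
    (fun x => f x ^ c).HasTemperateGrowth := by
  refine Function.HasTemperateGrowth.comp' (g := fun w : ℂ => w ^ c) (t := {z | δ < z.re})
    (Set.range_subset_iff.2 hfδ) (isOpen_lt_re δ).uniqueDiffOn
    (contDiffOn_cpow_const_of_lt_re hδ.le c) (fun N => ?_) hf
  choose k C hC hbound using fun n => exists_norm_iteratedFDerivWithin_cpow_le hδ n c
  refine ⟨(Finset.range (N + 1)).sup k, ∑ n ∈ Finset.range (N + 1), C n,
    Finset.sum_nonneg fun n _ => hC n, fun n hn z hz => (hbound n z hz).trans ?_⟩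
  have hmem : n ∈ Finset.range (N + 1) := Finset.mem_range_succ_iff.2 hn
  gcongr
  · exact Finset.sum_nonneg fun n _ => hC n
  · exact Finset.single_le_sum (f := C) (fun n _ => hC n) hmem
  · linarith [norm_nonneg z]
  · exact Finset.le_sup hmem

end TemperateGrowth

/-! ### The symbols -/

section Symbols

variable {αs γs : ℝ}

/-- The symbol of `L = γₛ² - Δ`. -/
def helmholtzSymbol (γs : ℝ) (ω : SpaceTime) : ℝ := γs ^ 2 + ‖ω.fst‖ ^ 2

lemma sq_le_helmholtzSymbol (γs : ℝ) (ω : SpaceTime) : γs ^ 2 ≤ helmholtzSymbol γs ω :=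
  le_add_of_nonneg_right (sq_nonneg _)

lemma helmholtzSymbol_pos (hγs : 0 < γs) (ω : SpaceTime) : 0 < helmholtzSymbol γs ω :=
  (pow_pos hγs 2).trans_le (sq_le_helmholtzSymbol γs ω)

lemma helmholtzSymbol_neg (γs : ℝ) (ω : SpaceTime) :
    helmholtzSymbol γs (-ω) = helmholtzSymbol γs ω := by
  simp [helmholtzSymbol]

lemma continuous_helmholtzSymbol (γs : ℝ) : Continuous (helmholtzSymbol γs) := by
  unfold helmholtzSymbol
  fun_prop

lemma hasTemperateGrowth_helmholtzSymbol_rpow (hγs : 0 < γs) (r : ℝ) :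
    (fun ω => ((helmholtzSymbol γs ω ^ r : ℝ) : ℂ)).HasTemperateGrowth := by
  have hbase : (fun ω => (helmholtzSymbol γs ω : ℂ)).HasTemperateGrowth :=
    Function.Complex.hasTemperateGrowth_ofReal.comp
      ((Function.HasTemperateGrowth.const (γs ^ 2)).add
        ((Function.hasTemperateGrowth_norm_sq Space).comp
          (WithLp.fstL 2 ℝ Space ℝ).hasTemperateGrowth))
  have hlt (ω : SpaceTime) : γs ^ 2 / 2 < ((helmholtzSymbol γs ω : ℝ) : ℂ).re :=
    (half_lt_self (pow_pos hγs 2)).trans_le (sq_le_helmholtzSymbol γs ω)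
  simpa only [Complex.ofReal_cpow (helmholtzSymbol_pos hγs _).le] using
    hasTemperateGrowth_cpow_const hbase (half_pos (pow_pos hγs 2)) hlt r

lemma hasTemperateGrowth_inv_precisionSymbol (αe : ℝ) (hγs : 0 < γs) (γe : ℝ) :
    (fun ω => (((precisionSymbol αe γs γe ω)⁻¹ : ℝ) : ℂ)).HasTemperateGrowth := by
  have hinv (ω : SpaceTime) : (((precisionSymbol αe γs γe ω)⁻¹ : ℝ) : ℂ) =
      ((γe ^ 2)⁻¹ : ℝ) * ((helmholtzSymbol γs ω ^ (-αe) : ℝ) : ℂ) := by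
    rw [← Complex.ofReal_mul, Real.rpow_neg (helmholtzSymbol_pos hγs ω).le, ← mul_inv]
    rfl
  simp_rw [hinv]
  exact (Function.HasTemperateGrowth.const _).mul (hasTemperateGrowth_helmholtzSymbol_rpow hγs _)

/-- The symbol of `γₜ ∂ₜ + L^(αₛ/2)`. -/
def heatSymbol (αs γt γs : ℝ) (ω : SpaceTime) : ℂ :=
  Complex.I * (γt * ω.snd : ℝ) + (helmholtzSymbol γs ω ^ (αs / 2) : ℝ)

lemma evolutionSymbol_eq_heatSymbol_cpow (αt αs γt γs : ℝ) (ω : SpaceTime) :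
    evolutionSymbol αt αs γt γs ω = heatSymbol αs γt γs ω ^ (αt : ℂ) :=
  rfl

lemma heatSymbol_re (αs γt γs : ℝ) (ω : SpaceTime) :
    (heatSymbol αs γt γs ω).re = helmholtzSymbol γs ω ^ (αs / 2) := by
  simp [heatSymbol]

lemma heatSymbol_im (αs γt γs : ℝ) (ω : SpaceTime) :
    (heatSymbol αs γt γs ω).im = γt * ω.snd := by
  simp [heatSymbol]

lemma conj_heatSymbol (αs γt γs : ℝ) (ω : SpaceTime) :
    (starRingEnd ℂ) (heatSymbol αs γt γs ω) = heatSymbol αs γt γs (-ω) := by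
  apply Complex.ext
  · simp [heatSymbol_re, helmholtzSymbol_neg]
  · simp [heatSymbol_im]

lemma heatSymbol_re_pos (hγs : 0 < γs) (αs γt : ℝ) (ω : SpaceTime) :
    0 < (heatSymbol αs γt γs ω).re := by
  rw [heatSymbol_re]
  exact Real.rpow_pos_of_pos (helmholtzSymbol_pos hγs ω) _

lemma heatSymbol_ne_zero (hγs : 0 < γs) (αs γt : ℝ) (ω : SpaceTime) :
    heatSymbol αs γt γs ω ≠ 0 := fun h =>
  (heatSymbol_re_pos hγs αs γt ω).ne' (by rw [h, Complex.zero_re])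

lemma conj_heatSymbol_cpow (hγs : 0 < γs) (αs γt c : ℝ) (ω : SpaceTime) :
    (starRingEnd ℂ) (heatSymbol αs γt γs ω ^ (c : ℂ)) = heatSymbol αs γt γs (-ω) ^ (c : ℂ) := by
  have harg : (heatSymbol αs γt γs ω).arg ≠ Real.pi :=
    (Complex.mem_slitPlane_iff_arg.1 (Or.inl (heatSymbol_re_pos hγs αs γt ω))).1
  rw [← conj_heatSymbol, Complex.conj_cpow _ _ harg, Complex.conj_ofReal]

lemma norm_sq_heatSymbol (hγs : 0 < γs) (αs γt : ℝ) (ω : SpaceTime) :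
    ‖heatSymbol αs γt γs ω‖ ^ 2 = γt ^ 2 * ω.snd ^ 2 + helmholtzSymbol γs ω ^ αs := by
  rw [← Complex.normSq_eq_norm_sq, Complex.normSq_apply, heatSymbol_re, heatSymbol_im,
    ← Real.rpow_add (helmholtzSymbol_pos hγs ω), add_halves]
  ring

lemma hasTemperateGrowth_heatSymbol_cpow (hαs : 0 ≤ αs) (hγs : 0 < γs) (γt : ℝ) (c : ℂ) :
    (fun ω => heatSymbol αs γt γs ω ^ c).HasTemperateGrowth := by
  have him : (fun ω : SpaceTime => Complex.I * ((γt * ω.snd : ℝ) : ℂ)).HasTemperateGrowth :=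
    (Function.HasTemperateGrowth.const _).mul (Function.Complex.hasTemperateGrowth_ofReal.comp
      ((Function.HasTemperateGrowth.const γt).mul (WithLp.sndL 2 ℝ Space ℝ).hasTemperateGrowth))
  have hpos : 0 < (γs ^ 2) ^ (αs / 2) := by positivity
  have hlt (ω : SpaceTime) : (γs ^ 2) ^ (αs / 2) / 2 < (heatSymbol αs γt γs ω).re := by
    rw [heatSymbol_re]
    exact (half_lt_self hpos).trans_le
      (Real.rpow_le_rpow (by positivity) (sq_le_helmholtzSymbol γs ω) (by positivity))
  exact hasTemperateGrowth_cpow_const (him.add (hasTemperateGrowth_helmholtzSymbol_rpow hγs _))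
    (half_pos hpos) hlt c

end Symbols

/-! ### Fourier multipliers on real test functions -/

section RealSchwartz

variable {V : Type*} [NormedAddCommGroup V] [InnerProductSpace ℝ V]

/-- A real test function as a complex valued one, so that its Fourier transform is again a test
function. -/
def complexify (φ : 𝓢(V, ℝ)) : 𝓢(V, ℂ) := φ.postcompCLM Complex.ofRealCLM

lemma complexify_apply (φ : 𝓢(V, ℝ)) (x : V) : complexify φ x = φ x := rfl

variable [FiniteDimensional ℝ V] [MeasurableSpace V] [BorelSpace V]

lemma fourier_complexify (φ : 𝓢(V, ℝ)) (ξ : V) :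
    𝓕 (complexify φ) ξ = 𝓕 (fun y => (φ y : ℂ)) ξ :=
  congrFun (SchwartzMap.fourier_coe _) ξ

lemma fourier_ofReal_neg (f : V → ℝ) (ξ : V) :
    𝓕 (fun y => (f y : ℂ)) (-ξ) = (starRingEnd ℂ) (𝓕 (fun y => (f y : ℂ)) ξ) := by
  simp only [Real.fourier_eq, Circle.smul_def]
  rw [← integral_conj]
  congr 1 with v
  simp [Circle.starRingEnd_addChar]

lemma conj_fourierInv_of_hermitian {g : V → ℂ} (hg : ∀ ξ, g (-ξ) = (starRingEnd ℂ) (g ξ)) (x : V) :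
    (starRingEnd ℂ) (𝓕⁻ g x) = 𝓕⁻ g x := by
  simp only [Real.fourierInv_eq, Circle.smul_def]
  rw [← integral_conj, ← integral_neg_eq_self]
  congr 1 with v
  simp [Circle.starRingEnd_addChar, hg]

lemma ofReal_integral_mul_eq_integral_fourier (φ ψ : 𝓢(V, ℝ)) :
    ((∫ x, φ x * ψ x : ℝ) : ℂ) =
      ∫ ξ, (starRingEnd ℂ) (𝓕 (complexify φ) ξ) * 𝓕 (complexify ψ) ξ := by
  have parseval := SchwartzMap.integral_inner_fourier_fourier (complexify φ) (complexify ψ)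
  simp only [RCLike.inner_apply'] at parseval
  rw [parseval, ← integral_complex_ofReal]
  simp [complexify_apply]

lemma integrable_conj_fourier_mul_fourier (φ ψ : 𝓢(V, ℝ)) :
    Integrable fun ξ => (starRingEnd ℂ) (𝓕 (complexify φ) ξ) * 𝓕 (complexify ψ) ξ :=
  ((𝓕 (complexify φ)).memLp 2).star.integrable_mul ((𝓕 (complexify ψ)).memLp 2)

end RealSchwartz

section Multipliers

variable {m : SpaceTime → ℂ}

lemma finrank_spaceTime : Module.finrank ℝ SpaceTime = 3 := by
  rw [(WithLp.linearEquiv 2 ℝ (Space × ℝ)).finrank_eq]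
  simp

lemma angularFourier_smul (φ : 𝓢(SpaceTime, ℝ)) (ξ : SpaceTime) :
    angularFourier φ ((2 * Real.pi) • ξ) = 𝓕 (complexify φ) ξ := by
  rw [angularFourier, smul_smul, inv_mul_cancel₀ (by positivity), one_smul, fourier_complexify]

lemma angularFourier_eq_fourier (φ : 𝓢(SpaceTime, ℝ)) (ω : SpaceTime) :
    angularFourier φ ω = 𝓕 (complexify φ) ((2 * Real.pi)⁻¹ • ω) :=
  (fourier_complexify φ _).symm

lemma continuous_angularFourier (φ : 𝓢(SpaceTime, ℝ)) : Continuous (angularFourier φ) := by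
  simp_rw [funext (angularFourier_eq_fourier φ)]
  exact (𝓕 (complexify φ)).continuous.comp (continuous_const_smul _)

lemma integrable_conj_angularFourier_mul (φ ψ : 𝓢(SpaceTime, ℝ)) :
    Integrable fun ω => (starRingEnd ℂ) (angularFourier φ ω) * angularFourier ψ ω := by
  rw [← integrable_comp_smul_iff volume _ (by positivity : (2 * Real.pi : ℝ) ≠ 0)]
  simpa only [angularFourier_smul] using integrable_conj_fourier_mul_fourier φ ψ

lemma ofReal_integral_mul_eq_integral_angularFourier (φ ψ : 𝓢(SpaceTime, ℝ)) :
    ((∫ x, φ x * ψ x : ℝ) : ℂ) =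
      (((2 * Real.pi) ^ 3)⁻¹ : ℝ) *
        ∫ ω, (starRingEnd ℂ) (angularFourier φ ω) * angularFourier ψ ω := by
  have hscale := Measure.integral_comp_smul volume
    (fun ω => (starRingEnd ℂ) (angularFourier φ ω) * angularFourier ψ ω) (2 * Real.pi)
  simp only [angularFourier_smul, finrank_spaceTime] at hscale
  rw [ofReal_integral_mul_eq_integral_fourier, hscale, abs_of_nonneg (by positivity),
    Complex.real_smul]

/-- The operator with symbol `m` on real test functions, with values in real test functions. It
agrees with `multiplierOp m` when `m` has temperate growth, and is the genuine Fourier multiplier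
(the real part taken here loses nothing) when moreover `m` is Hermitian. -/
def schwartzMultiplier (m : SpaceTime → ℂ) (φ : 𝓢(SpaceTime, ℝ)) : 𝓢(SpaceTime, ℝ) :=
  (SchwartzMap.fourierMultiplierCLM ℂ (fun ξ => m ((2 * Real.pi) • ξ))
    (complexify φ)).postcompCLM Complex.reCLM

lemma fourierMultiplierCLM_complexify_apply (hm : m.HasTemperateGrowth) (φ : 𝓢(SpaceTime, ℝ))
    (x : SpaceTime) :
    SchwartzMap.fourierMultiplierCLM ℂ (fun ξ => m ((2 * Real.pi) • ξ)) (complexify φ) x =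
      𝓕⁻ (fun ξ : SpaceTime => m ((2 * Real.pi) • ξ) * 𝓕 (fun y => (φ y : ℂ)) ξ) x := by
  have hm' : (fun ξ => m ((2 * Real.pi) • ξ)).HasTemperateGrowth :=
    hm.comp ((2 * Real.pi) • ContinuousLinearMap.id ℝ SpaceTime).hasTemperateGrowth
  rw [SchwartzMap.fourierMultiplierCLM_apply, SchwartzMap.fourierInv_coe]
  refine congrArg (fun g : SpaceTime → ℂ => 𝓕⁻ g x) (funext fun ξ => ?_)
  rw [SchwartzMap.smulLeftCLM_apply_apply hm', fourier_complexify, smul_eq_mul]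

lemma schwartzMultiplier_apply (hm : m.HasTemperateGrowth) (φ : 𝓢(SpaceTime, ℝ)) (x : SpaceTime) :
    schwartzMultiplier m φ x = multiplierOp m φ x := by
  rw [schwartzMultiplier, SchwartzMap.postcompCLM_apply,
    fourierMultiplierCLM_complexify_apply hm]
  rfl

lemma complexify_schwartzMultiplier (hm : m.HasTemperateGrowth)
    (hsymm : ∀ ω, m (-ω) = (starRingEnd ℂ) (m ω)) (φ : 𝓢(SpaceTime, ℝ)) :
    complexify (schwartzMultiplier m φ) =
      SchwartzMap.fourierMultiplierCLM ℂ (fun ξ => m ((2 * Real.pi) • ξ)) (complexify φ) := by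
  ext x
  rw [complexify_apply]
  refine Complex.conj_eq_iff_re.1 ?_
  rw [fourierMultiplierCLM_complexify_apply hm]
  refine conj_fourierInv_of_hermitian (fun ξ => ?_) x
  rw [smul_neg, hsymm, fourier_ofReal_neg, map_mul]

lemma angularFourier_schwartzMultiplier (hm : m.HasTemperateGrowth)
    (hsymm : ∀ ω, m (-ω) = (starRingEnd ℂ) (m ω)) (φ : 𝓢(SpaceTime, ℝ)) (ω : SpaceTime) :
    angularFourier (schwartzMultiplier m φ) ω = m ω * angularFourier φ ω := by
  have hm' : (fun ξ => m ((2 * Real.pi) • ξ)).HasTemperateGrowth :=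
    hm.comp ((2 * Real.pi) • ContinuousLinearMap.id ℝ SpaceTime).hasTemperateGrowth
  rw [angularFourier_eq_fourier, complexify_schwartzMultiplier hm hsymm,
    SchwartzMap.fourierMultiplierCLM_apply, FourierTransform.fourier_fourierInv_eq,
    SchwartzMap.smulLeftCLM_apply_apply hm', ← angularFourier_eq_fourier,
    smul_inv_smul₀ (by positivity), smul_eq_mul]

lemma multiplierOp_schwartzMultiplier {m' : SpaceTime → ℂ} (hm : m.HasTemperateGrowth)
    (hsymm : ∀ ω, m (-ω) = (starRingEnd ℂ) (m ω)) (hmul : ∀ ω, m' ω * m ω = 1)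
    (φ : 𝓢(SpaceTime, ℝ)) (x : SpaceTime) :
    multiplierOp m' (schwartzMultiplier m φ) x = φ x := by
  have hcancel : (fun ξ : SpaceTime => m' ((2 * Real.pi) • ξ) *
      𝓕 (fun y => (schwartzMultiplier m φ y : ℂ)) ξ) = 𝓕 (complexify φ) := by
    ext ξ
    rw [← fourier_complexify, ← angularFourier_smul, angularFourier_schwartzMultiplier hm hsymm,
      ← mul_assoc, hmul, one_mul, angularFourier_smul]
  rw [multiplierOp, hcancel, ← SchwartzMap.fourierInv_coe, FourierTransform.fourierInv_fourier_eq,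
    complexify_apply, Complex.ofReal_re]

end Multipliers

/-! ### The space-time spectrum of the solution -/

section FieldSpectrum

variable {αt αs αe γt γs γe : ℝ} {Ω : Type*} [MeasurableSpace Ω] {P : Measure Ω}

lemma covariance_congr_ae {X X' Y Y' : Ω → ℝ} (hX : X =ᵐ[P] X') (hY : Y =ᵐ[P] Y') :
    cov[X, Y; P] = cov[X', Y'; P] := by
  rw [covariance, covariance, integral_congr_ae hX, integral_congr_ae hY]
  refine integral_congr_ae ?_
  filter_upwards [hX, hY] with w hXw hYw
  rw [hXw, hYw]

/-- The space-time spectral density `(2π)⁻³ |σ|⁻² Q⁻¹` of the solution, where `σ` is the symbol of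
the evolution operator. -/
def fieldSpectrum (αt αs αe γt γs γe : ℝ) (ω : SpaceTime) : ℝ :=
  ((2 * Real.pi) ^ 3)⁻¹ * (γe ^ 2)⁻¹ *
    ((γt ^ 2 * ω.snd ^ 2 + helmholtzSymbol γs ω ^ αs) ^ (-αt) * helmholtzSymbol γs ω ^ (-αe))

lemma fieldSpectrum_eq_norm_sq (hγs : 0 < γs) (ω : SpaceTime) :
    fieldSpectrum αt αs αe γt γs γe ω =
      ((2 * Real.pi) ^ 3)⁻¹ * (‖heatSymbol αs γt γs ω ^ ((-αt : ℝ) : ℂ)‖ ^ 2 *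
        (precisionSymbol αe γs γe ω)⁻¹) := by
  have hnorm : ‖heatSymbol αs γt γs ω ^ ((-αt : ℝ) : ℂ)‖ ^ 2 =
      (γt ^ 2 * ω.snd ^ 2 + helmholtzSymbol γs ω ^ αs) ^ (-αt) := by
    rw [Complex.norm_cpow_real, ← norm_sq_heatSymbol hγs, Real.rpow_pow_comm (norm_nonneg _)]
  have hprec : precisionSymbol αe γs γe ω = γe ^ 2 * helmholtzSymbol γs ω ^ αe := rfl
  rw [hnorm, hprec, fieldSpectrum, mul_inv, Real.rpow_neg (helmholtzSymbol_pos hγs ω).le αe]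
  ring

lemma fieldSpectrum_nonneg (hγs : 0 < γs) (ω : SpaceTime) :
    0 ≤ fieldSpectrum αt αs αe γt γs γe ω := by
  have := helmholtzSymbol_pos hγs ω
  unfold fieldSpectrum
  positivity

lemma continuous_fieldSpectrum (hγs : 0 < γs) :
    Continuous (fieldSpectrum αt αs αe γt γs γe) := by
  have hpow (r : ℝ) : Continuous fun ω => helmholtzSymbol γs ω ^ r :=
    (continuous_helmholtzSymbol γs).rpow_const fun ω => Or.inl (helmholtzSymbol_pos hγs ω).ne'
  have hbase (ω : SpaceTime) : γt ^ 2 * ω.snd ^ 2 + helmholtzSymbol γs ω ^ αs ≠ 0 := by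
    have := helmholtzSymbol_pos hγs ω
    positivity
  have hsum : Continuous fun ω : SpaceTime =>
      γt ^ 2 * ω.snd ^ 2 + helmholtzSymbol γs ω ^ αs :=
    Continuous.add (by fun_prop) (hpow αs)
  exact continuous_const.mul ((hsum.rpow_const fun ω => Or.inl (hbase ω)).mul (hpow (-αe)))

/-- The test function `ψ` with `⟨u, φ⟩ = ⟨W, ψ⟩`: the inverse of the transposed evolution operator
applied to `φ`. -/
def transposedPreimage (αt αs γt γs : ℝ) (φ : 𝓢(SpaceTime, ℝ)) : 𝓢(SpaceTime, ℝ) :=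
  schwartzMultiplier (fun ω => heatSymbol αs γt γs (-ω) ^ ((-αt : ℝ) : ℂ)) φ

lemma hasTemperateGrowth_heatSymbol_neg_cpow (hαs : 0 ≤ αs) (hγs : 0 < γs) (γt c : ℝ) :
    (fun ω => heatSymbol αs γt γs (-ω) ^ (c : ℂ)).HasTemperateGrowth :=
  (hasTemperateGrowth_heatSymbol_cpow hαs hγs γt c).comp
    (-ContinuousLinearMap.id ℝ SpaceTime).hasTemperateGrowth

lemma angularFourier_transposedPreimage (hαs : 0 ≤ αs) (hγs : 0 < γs) (αt γt : ℝ)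
    (φ : 𝓢(SpaceTime, ℝ)) (ω : SpaceTime) :
    angularFourier (transposedPreimage αt αs γt γs φ) ω =
      (starRingEnd ℂ) (heatSymbol αs γt γs ω ^ ((-αt : ℝ) : ℂ)) * angularFourier φ ω := by
  rw [transposedPreimage, angularFourier_schwartzMultiplier
    (hasTemperateGrowth_heatSymbol_neg_cpow hαs hγs γt (-αt))
    (fun ω => (conj_heatSymbol_cpow hγs αs γt (-αt) (-ω)).symm), conj_heatSymbol_cpow hγs]

lemma multiplierOp_transposedPreimage (hαs : 0 ≤ αs) (hγs : 0 < γs) (αt γt : ℝ)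
    (φ : 𝓢(SpaceTime, ℝ)) (x : SpaceTime) :
    multiplierOp (fun ω => evolutionSymbol αt αs γt γs (-ω))
      (transposedPreimage αt αs γt γs φ) x = φ x := by
  refine multiplierOp_schwartzMultiplier (hasTemperateGrowth_heatSymbol_neg_cpow hαs hγs γt (-αt))
    (fun ω => (conj_heatSymbol_cpow hγs αs γt (-αt) (-ω)).symm) (fun ω => ?_) φ x
  rw [evolutionSymbol_eq_heatSymbol_cpow, ← Complex.cpow_add _ _ (heatSymbol_ne_zero hγs αs γt _),
    ← Complex.ofReal_add, add_neg_cancel, Complex.ofReal_zero, Complex.cpow_zero]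

/-- `Q⁻¹` applied to a test function. -/
def inversePrecision (αe γs γe : ℝ) (φ : 𝓢(SpaceTime, ℝ)) : 𝓢(SpaceTime, ℝ) :=
  schwartzMultiplier (fun ω => ((precisionSymbol αe γs γe ω)⁻¹ : ℝ)) φ

lemma angularFourier_inversePrecision (hγs : 0 < γs) (αe γe : ℝ) (φ : 𝓢(SpaceTime, ℝ))
    (ω : SpaceTime) :
    angularFourier (inversePrecision αe γs γe φ) ω =
      ((precisionSymbol αe γs γe ω)⁻¹ : ℝ) * angularFourier φ ω :=
  angularFourier_schwartzMultiplier (hasTemperateGrowth_inv_precisionSymbol αe hγs γe)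
    (fun ω => by simp [precisionSymbol]) φ ω

variable {W u : 𝓢(SpaceTime, ℝ) → Ω → ℝ}

lemma IsNoise.memLp (hW : IsNoise αe γs γe P W) (φ : 𝓢(SpaceTime, ℝ)) : MemLp (W φ) 2 P :=
  (hW.gaussian.hasGaussianLaw_eval φ).memLp_two

lemma IsNoise.covariance_eq_integral_inversePrecision (hγs : 0 < γs) (hW : IsNoise αe γs γe P W)
    (φ ψ : 𝓢(SpaceTime, ℝ)) :
    cov[W φ, W ψ; P] = ∫ x, φ x * inversePrecision αe γs γe ψ x := by
  rw [hW.covariance_eq]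
  simp_rw [inversePrecision,
    schwartzMultiplier_apply (hasTemperateGrowth_inv_precisionSymbol αe hγs γe)]

lemma IsSolution.ae_eq_transposedPreimage (hαs : 0 ≤ αs) (hγs : 0 < γs)
    (hu : IsSolution αt αs γt γs P W u) (φ : 𝓢(SpaceTime, ℝ)) :
    u φ =ᵐ[P] W (transposedPreimage αt αs γt γs φ) :=
  hu _ _ fun x => (multiplierOp_transposedPreimage hαs hγs αt γt φ x).symm

lemma IsSolution.integral_eq_zero (hαs : 0 ≤ αs) (hγs : 0 < γs) (hW : IsNoise αe γs γe P W)
    (hu : IsSolution αt αs γt γs P W u) (φ : 𝓢(SpaceTime, ℝ)) : ∫ w, u φ w ∂P = 0 := by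
  rw [integral_congr_ae (hu.ae_eq_transposedPreimage hαs hγs φ), hW.centred]

lemma angularFourier_mul_fieldSpectrum (hαs : 0 ≤ αs) (hγs : 0 < γs) (φ ψ : 𝓢(SpaceTime, ℝ))
    (ω : SpaceTime) :
    (starRingEnd ℂ) (angularFourier φ ω) * angularFourier ψ ω *
        (fieldSpectrum αt αs αe γt γs γe ω : ℂ) =
      (((2 * Real.pi) ^ 3)⁻¹ : ℝ) *
        ((starRingEnd ℂ) (angularFourier (transposedPreimage αt αs γt γs φ) ω) *
          angularFourier (inversePrecision αe γs γe (transposedPreimage αt αs γt γs ψ)) ω) := by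
  rw [angularFourier_inversePrecision hγs, angularFourier_transposedPreimage hαs hγs,
    angularFourier_transposedPreimage hαs hγs, fieldSpectrum_eq_norm_sq hγs, map_mul,
    Complex.conj_conj, Complex.ofReal_mul, Complex.ofReal_mul (‖_‖ ^ 2),
    ← Complex.normSq_eq_norm_sq, Complex.normSq_eq_conj_mul_self]
  ring

theorem IsSolution.isSpectrum (hαs : 0 ≤ αs) (hγs : 0 < γs) (hW : IsNoise αe γs γe P W)
    (hu : IsSolution αt αs γt γs P W u) :
    IsSpectrum P u (fieldSpectrum αt αs αe γt γs γe) where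
  nonneg := fieldSpectrum_nonneg hγs
  measurable := (continuous_fieldSpectrum hγs).measurable
  memLp φ := (memLp_congr_ae (hu.ae_eq_transposedPreimage hαs hγs φ)).2 (hW.memLp _)
  integrable φ ψ := by
    simp_rw [angularFourier_mul_fieldSpectrum hαs hγs]
    exact (integrable_conj_angularFourier_mul _ _).const_mul _
  covariance_eq φ ψ := by
    simp_rw [angularFourier_mul_fieldSpectrum hαs hγs]
    rw [integral_const_mul, ← ofReal_integral_mul_eq_integral_angularFourier,
      ← hW.covariance_eq_integral_inversePrecision hγs,
      covariance_congr_ae (hu.ae_eq_transposedPreimage hαs hγs φ)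
        (hu.ae_eq_transposedPreimage hαs hγs ψ)]

end FieldSpectrum

/-! ### Euler's integral for `₂F₁(a, b; b + 1; ·)` -/

section Hypergeometric

open Set

lemma isOpen_one_sub_mem_slitPlane : IsOpen {z : ℂ | 1 - z ∈ Complex.slitPlane} :=
  Complex.isOpen_slitPlane.preimage (by fun_prop : Continuous fun z : ℂ => 1 - z)

lemma one_sub_mul_mem_slitPlane {z : ℂ} (hz : 1 - z ∈ Complex.slitPlane) {w : ℝ}
    (hw : w ∈ Icc (0 : ℝ) 1) : 1 - z * w ∈ Complex.slitPlane := by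
  have hstar := Complex.starConvex_one_slitPlane.add_smul_mem (y := -z)
    (by simpa [sub_eq_add_neg] using hz) hw.1 hw.2
  rwa [Complex.real_smul, mul_neg, ← sub_eq_add_neg, mul_comm] at hstar

lemma isPreconnected_one_sub_mem_slitPlane :
    IsPreconnected {z : ℂ | 1 - z ∈ Complex.slitPlane} := by
  have hstar : StarConvex ℝ (0 : ℂ) {z : ℂ | 1 - z ∈ Complex.slitPlane} := by
    rw [starConvex_zero_iff]
    intro z hz t ht0 ht1
    simpa [mul_comm] using one_sub_mul_mem_slitPlane hz ⟨ht0, ht1⟩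
  exact (hstar.isPathConnected (by simp)).isConnected.isPreconnected

lemma continuousOn_one_sub_mul_cpow (c : ℂ) :
    ContinuousOn (fun p : ℂ × ℝ => (1 - p.1 * p.2) ^ c)
      ({z : ℂ | 1 - z ∈ Complex.slitPlane} ×ˢ Icc (0 : ℝ) 1) := by
  refine ContinuousOn.cpow_const ?_ fun p hp => one_sub_mul_mem_slitPlane hp.1 hp.2
  fun_prop

lemma hasDerivAt_one_sub_mul_cpow {z : ℂ} (hz : 1 - z ∈ Complex.slitPlane) {w : ℝ}
    (hw : w ∈ Icc (0 : ℝ) 1) (c : ℂ) :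
    HasDerivAt (fun z : ℂ => (1 - z * w) ^ c) (c * (1 - z * w) ^ (c - 1) * (-w)) z := by
  have hlin : HasDerivAt (fun z : ℂ => 1 - z * w) (-w : ℂ) z := by
    simpa using ((hasDerivAt_id z).mul_const (w : ℂ)).const_sub 1
  exact hlin.cpow_const (one_sub_mul_mem_slitPlane hz hw)

section Weight

variable {g : ℝ → ℂ} {z : ℂ}

lemma integrableOn_mul_of_continuousOn (hg : IntegrableOn g (Ioo 0 1)) {f : ℂ × ℝ → ℂ}
    (hf : ContinuousOn f ({z : ℂ | 1 - z ∈ Complex.slitPlane} ×ˢ Icc (0 : ℝ) 1))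
    (hz : 1 - z ∈ Complex.slitPlane) :
    IntegrableOn (fun w => g w * f (z, w)) (Ioo 0 1) := by
  rw [← integrableOn_Icc_iff_integrableOn_Ioo] at hg ⊢
  exact hg.mul_continuousOn (hf.comp (by fun_prop) fun w hw => ⟨hz, hw⟩) isCompact_Icc

lemma differentiableOn_integral_mul_one_sub_mul_cpow (hg : IntegrableOn g (Ioo 0 1)) (c : ℂ) :
    DifferentiableOn ℂ (fun z => ∫ w in Ioo (0 : ℝ) 1, g w * (1 - z * w) ^ c)
      {z | 1 - z ∈ Complex.slitPlane} := by
  intro z₀ hz₀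
  obtain ⟨ε, hε, hball⟩ := Metric.nhds_basis_closedBall.mem_iff.1
    (isOpen_one_sub_mem_slitPlane.mem_nhds hz₀)
  let f' : ℂ × ℝ → ℂ := fun p => c * (1 - p.1 * p.2) ^ (c - 1) * (-p.2)
  have hf' : ContinuousOn f' ({z : ℂ | 1 - z ∈ Complex.slitPlane} ×ˢ Icc (0 : ℝ) 1) :=
    (continuousOn_const.mul (continuousOn_one_sub_mul_cpow (c - 1))).mul (by fun_prop)
  obtain ⟨M, hM⟩ := ((isCompact_closedBall z₀ ε).prod
    (isCompact_Icc (a := (0 : ℝ)) (b := 1))).exists_bound_of_continuousOn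
      (hf'.mono (prod_mono hball subset_rfl))
  refine (hasDerivAt_integral_of_dominated_loc_of_deriv_le
    (F := fun z w => g w * (1 - z * w) ^ c) (F' := fun z w => g w * f' (z, w))
    (bound := fun w => ‖g w‖ * M) (Metric.closedBall_mem_nhds z₀ hε)
    ?_ ?_ ?_ ?_ ?_ ?_).2.differentiableAt.differentiableWithinAt
  · filter_upwards [isOpen_one_sub_mem_slitPlane.mem_nhds hz₀] with z hz
    exact (integrableOn_mul_of_continuousOn hg (continuousOn_one_sub_mul_cpow c)
      hz).aestronglyMeasurable
  · exact integrableOn_mul_of_continuousOn hg (continuousOn_one_sub_mul_cpow c) hz₀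
  · exact (integrableOn_mul_of_continuousOn hg hf' hz₀).aestronglyMeasurable
  · filter_upwards [ae_restrict_mem measurableSet_Ioo] with w hw z hz
    rw [norm_mul]
    gcongr
    exact hM (z, w) ⟨hz, Ioo_subset_Icc_self hw⟩
  · exact hg.norm.mul_const M
  · filter_upwards [ae_restrict_mem measurableSet_Ioo] with w hw z hz
    exact (hasDerivAt_one_sub_mul_cpow (hball hz) (Ioo_subset_Icc_self hw) c).const_mul _

/-- The coefficients `(a)ₙ / n!` of the power series of `(1 - z)⁻ᵃ`. -/
def binomialCoeff (a : ℂ) (n : ℕ) : ℂ := (n.factorial : ℂ)⁻¹ * (ascPochhammer ℂ n).eval a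

lemma ring_choose_eq_binomialCoeff (a : ℂ) (n : ℕ) :
    Ring.choose (a + n - 1) n = binomialCoeff a n := by
  have hmultichoose := Ring.factorial_nsmul_multichoose_eq_ascPochhammer a n
  rw [Polynomial.ascPochhammer_smeval_eq_eval, nsmul_eq_mul] at hmultichoose
  rw [binomialCoeff, ← hmultichoose, Ring.choose,
    inv_mul_cancel_left₀ (by exact_mod_cast n.factorial_ne_zero)]
  congr 1
  ring

lemma hasSum_binomialCoeff (a : ℂ) (hz : ‖z‖ < 1) :
    HasSum (fun n => binomialCoeff a n * z ^ n) ((1 - z) ^ (-a)) := by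
  have hmem : z ∈ Metric.eball (0 : ℂ) 1 := by simpa [← ofReal_norm] using hz
  have hsum := (Complex.one_div_one_sub_cpow_hasFPowerSeriesOnBall_zero a).hasSum hmem
  simpa only [FormalMultilinearSeries.ofScalars_apply_eq, ring_choose_eq_binomialCoeff, zero_add,
    smul_eq_mul, one_div, ← Complex.cpow_neg] using hsum

lemma summable_norm_binomialCoeff (a : ℂ) (hz : ‖z‖ < 1) :
    Summable fun n => ‖binomialCoeff a n * z ^ n‖ :=
  (hasSum_binomialCoeff a hz).summable.norm

lemma hasSum_integral_mul_one_sub_mul_cpow (hg : IntegrableOn g (Ioo 0 1)) (a : ℂ)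
    (hz : ‖z‖ < 1) :
    HasSum (fun n => binomialCoeff a n * z ^ n * ∫ w in Ioo (0 : ℝ) 1, g w * (w : ℂ) ^ n)
      (∫ w in Ioo (0 : ℝ) 1, g w * (1 - z * w) ^ (-a)) := by
  let F : ℕ → ℝ → ℂ := fun n w => binomialCoeff a n * z ^ n * (g w * (w : ℂ) ^ n)
  have hgn (n : ℕ) : IntegrableOn (fun w => g w * (w : ℂ) ^ n) (Ioo 0 1) :=
    integrableOn_mul_of_continuousOn (z := 0) (f := fun p => (p.2 : ℂ) ^ n) hg
      (by fun_prop) (by simp)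
  have hF_norm (n : ℕ) : ∫ w in Ioo (0 : ℝ) 1, ‖F n w‖ ≤
      ‖binomialCoeff a n * z ^ n‖ * ∫ w in Ioo (0 : ℝ) 1, ‖g w‖ := by
    rw [← integral_const_mul]
    refine setIntegral_mono_on ((hgn n).const_mul _).norm (hg.norm.const_mul _)
      measurableSet_Ioo fun w hw => ?_
    rw [norm_mul, norm_mul (g w), norm_pow, Complex.norm_of_nonneg hw.1.le]
    gcongr
    exact mul_le_of_le_one_right (norm_nonneg _) (pow_le_one₀ hw.1.le hw.2.le)
  have hF_sum : Summable fun n => ∫ w in Ioo (0 : ℝ) 1, ‖F n w‖ :=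
    Summable.of_nonneg_of_le (fun n => by positivity) hF_norm
      ((summable_norm_binomialCoeff a hz).mul_right _)
  have hF_tsum : ∫ w in Ioo (0 : ℝ) 1, ∑' n, F n w =
      ∫ w in Ioo (0 : ℝ) 1, g w * (1 - z * w) ^ (-a) := by
    refine setIntegral_congr_fun measurableSet_Ioo fun w hw => ?_
    have hzw : ‖z * w‖ < 1 := by
      rw [norm_mul, Complex.norm_of_nonneg hw.1.le]
      exact mul_lt_one_of_nonneg_of_lt_one_left (norm_nonneg z) hz hw.2.le
    rw [← ((hasSum_binomialCoeff a hzw).mul_left (g w)).tsum_eq]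
    exact tsum_congr fun n => by simp only [F]; ring
  rw [← hF_tsum]
  simpa only [F, integral_const_mul] using
    hasSum_integral_of_summable_integral_norm (fun n => (hgn n).const_mul _) hF_sum

end Weight

variable {a b z : ℂ}

/-- Euler's integral for `₂F₁(a, b; b + 1; z)`. -/
def eulerIntegral (a b z : ℂ) : ℂ :=
  b * ∫ w in Ioo (0 : ℝ) 1, (w : ℂ) ^ (b - 1) * (1 - z * w) ^ (-a)

lemma integrableOn_cpow_sub_one (hb : 0 < b.re) :
    IntegrableOn (fun w : ℝ => (w : ℂ) ^ (b - 1)) (Ioo 0 1) :=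
  (intervalIntegral.integrableOn_Ioo_cpow_iff one_pos).2 (by simpa using hb)

lemma differentiableOn_eulerIntegral (a : ℂ) (hb : 0 < b.re) :
    DifferentiableOn ℂ (eulerIntegral a b) {z | 1 - z ∈ Complex.slitPlane} :=
  (differentiableOn_integral_mul_one_sub_mul_cpow (integrableOn_cpow_sub_one hb) (-a)).const_mul b

lemma add_natCast_ne_zero (hb : 0 < b.re) (n : ℕ) : b + n ≠ 0 := fun h => by
  have hre := congrArg Complex.re h
  rw [Complex.add_re, Complex.natCast_re, Complex.zero_re] at hre
  exact (add_pos_of_pos_of_nonneg hb n.cast_nonneg).ne' hre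

lemma integral_cpow_sub_one_mul_pow (hb : 0 < b.re) (n : ℕ) :
    ∫ w in Ioo (0 : ℝ) 1, (w : ℂ) ^ (b - 1) * (w : ℂ) ^ n = (b + n)⁻¹ := by
  have hre : -1 < (b - 1 + n).re := by
    simp only [Complex.add_re, Complex.sub_re, Complex.one_re, Complex.natCast_re]
    linarith [n.cast_nonneg (α := ℝ)]
  calc ∫ w in Ioo (0 : ℝ) 1, (w : ℂ) ^ (b - 1) * (w : ℂ) ^ n
      = ∫ w in Ioo (0 : ℝ) 1, (w : ℂ) ^ (b - 1 + n) :=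
        setIntegral_congr_fun measurableSet_Ioo fun w hw => by
          rw [Complex.cpow_add _ _ (Complex.ofReal_ne_zero.2 hw.1.ne'), Complex.cpow_natCast]
    _ = ∫ w in (0 : ℝ)..1, (w : ℂ) ^ (b - 1 + n) := by
        rw [intervalIntegral.integral_of_le zero_le_one, integral_Ioc_eq_integral_Ioo]
    _ = (b + n)⁻¹ := by
        have hexp : b - 1 + n + 1 = b + n := by ring
        rw [integral_cpow (Or.inl hre), hexp, Complex.ofReal_one, Complex.one_cpow,
          Complex.ofReal_zero, Complex.zero_cpow (add_natCast_ne_zero hb n), sub_zero, one_div]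

lemma ascPochhammer_eval_mul_add (b : ℂ) (n : ℕ) :
    (ascPochhammer ℂ n).eval b * (b + n) = b * (ascPochhammer ℂ n).eval (b + 1) := by
  simpa using congrArg (Polynomial.eval b)
    ((ascPochhammer_succ_right ℂ n).symm.trans (ascPochhammer_succ_left ℂ n))

lemma ascPochhammer_eval_add_one_ne_zero (hb : 0 < b.re) (n : ℕ) :
    (ascPochhammer ℂ n).eval (b + 1) ≠ 0 := by
  rw [Ne, ascPochhammer_eval_eq_zero_iff]
  rintro ⟨k, -, hk⟩
  refine add_natCast_ne_zero hb (k + 1) ?_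
  push_cast
  linear_combination hk

lemma eulerIntegral_eq_ordinaryHypergeometric (a : ℂ) (hb : 0 < b.re) (hz : ‖z‖ < 1) :
    eulerIntegral a b z = ordinaryHypergeometric a b (b + 1) z := by
  rw [eulerIntegral, ← (hasSum_integral_mul_one_sub_mul_cpow (integrableOn_cpow_sub_one hb) a
    hz).tsum_eq, ← tsum_mul_left, ordinaryHypergeometric_eq_tsum]
  refine tsum_congr fun n => ?_
  have hne := ascPochhammer_eval_add_one_ne_zero hb n
  have hbn := add_natCast_ne_zero hb n
  have hratio : b * (b + n)⁻¹ =
      (ascPochhammer ℂ n).eval b * ((ascPochhammer ℂ n).eval (b + 1))⁻¹ := by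
    rw [← div_eq_mul_inv, ← div_eq_mul_inv, div_eq_div_iff hbn hne, ascPochhammer_eval_mul_add]
  rw [integral_cpow_sub_one_mul_pow hb, binomialCoeff, smul_eq_mul]
  linear_combination (n.factorial : ℂ)⁻¹ * (ascPochhammer ℂ n).eval a * z ^ n * hratio

lemma isGaussHypergeometric_eulerIntegral (a : ℂ) (hb : 0 < b.re) :
    IsGaussHypergeometric a b (b + 1) (eulerIntegral a b) :=
  ⟨differentiableOn_eulerIntegral a hb,
    fun _ hz => eulerIntegral_eq_ordinaryHypergeometric a hb hz⟩

lemma IsGaussHypergeometric.eqOn {a b c : ℂ} {F G : ℂ → ℂ} (hF : IsGaussHypergeometric a b c F)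
    (hG : IsGaussHypergeometric a b c G) : EqOn F G {z | 1 - z ∈ Complex.slitPlane} := by
  refine (hF.1.analyticOnNhd isOpen_one_sub_mem_slitPlane).eqOn_of_preconnected_of_eventuallyEq
    (hG.1.analyticOnNhd isOpen_one_sub_mem_slitPlane) isPreconnected_one_sub_mem_slitPlane
    (z₀ := 0) (by simp) ?_
  filter_upwards [Metric.ball_mem_nhds (0 : ℂ) one_pos] with z hz
  rw [mem_ball_zero_iff] at hz
  rw [hF.2 z hz, hG.2 z hz]

lemma gaussHypergeometric_eq_eulerIntegral (a : ℂ) (hb : 0 < b.re)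
    (hz : 1 - z ∈ Complex.slitPlane) :
    gaussHypergeometric a b (b + 1) z = eulerIntegral a b z := by
  have hexists : ∃ F, IsGaussHypergeometric a b (b + 1) F :=
    ⟨_, isGaussHypergeometric_eulerIntegral a hb⟩
  rw [gaussHypergeometric, dif_pos hexists]
  exact hexists.choose_spec.eqOn (isGaussHypergeometric_eulerIntegral a hb) hz

end Hypergeometric

section EulerBounds

open Set

/-- Euler's integral for `b⁻¹ ₂F₁(a, b; b + 1; -x)`. -/
def negEulerIntegral (a b x : ℝ) : ℝ := ∫ w in Ioo (0 : ℝ) 1, w ^ (b - 1) * (1 + x * w) ^ (-a)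

variable {a b x : ℝ}

theorem gaussHypergeometric_neg_ofReal (a : ℝ) (hb : 0 < b) (hx : 0 ≤ x) :
    gaussHypergeometric (a : ℂ) (b : ℂ) ((b + 1 : ℝ) : ℂ) ((-x : ℝ) : ℂ) =
      ((b * negEulerIntegral a b x : ℝ) : ℂ) := by
  have hslit : 1 - ((-x : ℝ) : ℂ) ∈ Complex.slitPlane := by
    rw [← Complex.ofReal_one, ← Complex.ofReal_sub, Complex.ofReal_mem_slitPlane, sub_neg_eq_add]
    positivity
  rw [Complex.ofReal_add, Complex.ofReal_one,
    gaussHypergeometric_eq_eulerIntegral (a : ℂ) (by simpa using hb) hslit, eulerIntegral,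
    negEulerIntegral, Complex.ofReal_mul, ← integral_complex_ofReal]
  refine congrArg _ (setIntegral_congr_fun measurableSet_Ioo fun w hw => ?_)
  have hpos : 0 ≤ 1 + x * w := by
    have := hw.1.le
    positivity
  rw [Complex.ofReal_mul, Complex.ofReal_cpow hw.1.le, Complex.ofReal_cpow hpos]
  push_cast
  ring_nf

lemma negEulerIntegral_nonneg (a b : ℝ) (hx : 0 ≤ x) : 0 ≤ negEulerIntegral a b x :=
  setIntegral_nonneg measurableSet_Ioo fun w hw => by
    have hw0 := hw.1
    positivity

lemma integrableOn_rpow_sub_one (hb : 0 < b) :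
    IntegrableOn (fun w : ℝ => w ^ (b - 1)) (Ioo 0 1) :=
  (intervalIntegral.integrableOn_Ioo_rpow_iff one_pos).2 (by linarith)

lemma setIntegral_Ioo_rpow_sub_one (hb : 0 < b) {y : ℝ} (hy : 0 ≤ y) :
    ∫ w in Ioo (0 : ℝ) y, w ^ (b - 1) = b⁻¹ * y ^ b := by
  rw [← integral_Ioc_eq_integral_Ioo, ← intervalIntegral.integral_of_le hy,
    integral_rpow (Or.inl (by linarith)), sub_add_cancel, Real.zero_rpow hb.ne', sub_zero,
    div_eq_inv_mul]

lemma integrableOn_negEulerIntegrand (a : ℝ) (hb : 0 < b) (hx : 0 ≤ x) :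
    IntegrableOn (fun w : ℝ => w ^ (b - 1) * (1 + x * w) ^ (-a)) (Ioo 0 1) := by
  have hpow := integrableOn_rpow_sub_one hb
  rw [← integrableOn_Icc_iff_integrableOn_Ioo] at hpow ⊢
  refine hpow.mul_continuousOn (ContinuousOn.rpow_const (by fun_prop) fun w hw => Or.inl ?_)
    isCompact_Icc
  have := hw.1
  positivity

lemma setIntegral_rpow_sub_one_mul_le_negEulerIntegral (a : ℝ) (hb : 0 < b) (hx : 0 ≤ x) {y : ℝ}
    (hy : y ∈ Icc (0 : ℝ) 1) {m : ℝ} (hm : ∀ w ∈ Ioo 0 y, m ≤ (1 + x * w) ^ (-a)) :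
    b⁻¹ * y ^ b * m ≤ negEulerIntegral a b x := by
  have hsub : Ioo 0 y ⊆ Ioo (0 : ℝ) 1 := Ioo_subset_Ioo_right hy.2
  have hint := integrableOn_negEulerIntegrand a hb hx
  calc b⁻¹ * y ^ b * m = ∫ w in Ioo 0 y, w ^ (b - 1) * m := by
        rw [integral_mul_const, setIntegral_Ioo_rpow_sub_one hb hy.1]
    _ ≤ ∫ w in Ioo 0 y, w ^ (b - 1) * (1 + x * w) ^ (-a) := by
        refine setIntegral_mono_on (((integrableOn_rpow_sub_one hb).mono_set hsub).mul_const m)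
          (hint.mono_set hsub) measurableSet_Ioo fun w hw => ?_
        have := hw.1
        gcongr
        exact hm w hw
    _ ≤ negEulerIntegral a b x := by
        refine setIntegral_mono_set hint ?_ (Filter.Eventually.of_forall hsub)
        filter_upwards [ae_restrict_mem measurableSet_Ioo] with w hw
        have := hw.1
        positivity

lemma eqOn_rpow_sub_one_mul_rpow (b p : ℝ) (hx : 0 ≤ x) :
    EqOn (fun w : ℝ => w ^ (b - p - 1) * x ^ (-p)) (fun w => w ^ (b - 1) * (x * w) ^ (-p))
      (Ioo 0 1) := fun w hw => by
  simp only
  rw [Real.mul_rpow hx hw.1.le, mul_left_comm, ← Real.rpow_add hw.1, mul_comm]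
  ring_nf

lemma integrableOn_rpow_sub_one_mul_rpow {p : ℝ} (hpb : p < b) (hx : 0 ≤ x) :
    IntegrableOn (fun w : ℝ => w ^ (b - 1) * (x * w) ^ (-p)) (Ioo 0 1) :=
  IntegrableOn.congr_fun ((integrableOn_rpow_sub_one (sub_pos.2 hpb)).mul_const _)
    (eqOn_rpow_sub_one_mul_rpow b p hx) measurableSet_Ioo

lemma setIntegral_rpow_sub_one_mul_rpow {p : ℝ} (hpb : p < b) (hx : 0 ≤ x) :
    ∫ w in Ioo (0 : ℝ) 1, w ^ (b - 1) * (x * w) ^ (-p) = (b - p)⁻¹ * x ^ (-p) := by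
  rw [← setIntegral_congr_fun measurableSet_Ioo (eqOn_rpow_sub_one_mul_rpow b p hx),
    integral_mul_const, setIntegral_Ioo_rpow_sub_one (sub_pos.2 hpb) zero_le_one, Real.one_rpow,
    mul_one]

lemma rpow_neg_le_negEulerIntegral_of_nonpos (ha : a ≤ 0) (hb : 0 < b) (hx : 0 ≤ x) :
    (b - a)⁻¹ * x ^ (-a) ≤ negEulerIntegral a b x := by
  rw [← setIntegral_rpow_sub_one_mul_rpow (ha.trans_lt hb) hx]
  refine setIntegral_mono_on (integrableOn_rpow_sub_one_mul_rpow (ha.trans_lt hb) hx)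
    (integrableOn_negEulerIntegrand a hb hx) measurableSet_Ioo fun w hw => ?_
  have hw0 := hw.1
  gcongr
  · exact neg_nonneg.2 ha
  · exact le_add_of_nonneg_left zero_le_one

lemma exists_pos_mul_rpow_neg_min_le_negEulerIntegral (a : ℝ) (hb : 0 < b) :
    ∃ c : ℝ, 0 < c ∧ ∀ x : ℝ, 1 ≤ x → c * x ^ (-min a b) ≤ negEulerIntegral a b x := by
  rcases lt_or_ge a 0 with ha | ha
  · exact ⟨(b - a)⁻¹, inv_pos.2 (by linarith), fun x hx => by
      rw [min_eq_left (ha.le.trans hb.le)]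
      exact rpow_neg_le_negEulerIntegral_of_nonpos ha.le hb (by linarith)⟩
  · refine ⟨b⁻¹ * 2 ^ (-a), by positivity, fun x hx => ?_⟩
    have hx0 : 0 < x := one_pos.trans_le hx
    rcases min_choice a b with hmin | hmin <;> rw [hmin]
    · refine le_of_eq_of_le ?_ (setIntegral_rpow_sub_one_mul_le_negEulerIntegral a hb hx0.le
        (y := 1) (m := (2 * x) ^ (-a)) ⟨zero_le_one, le_rfl⟩ fun w hw => ?_)
      · rw [Real.mul_rpow zero_le_two hx0.le, Real.one_rpow]
        ring
      · have hxw : x * w ≤ x := mul_le_of_le_one_right hx0.le hw.2.le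
        have hxw0 : 0 < x * w := mul_pos hx0 hw.1
        exact Real.rpow_le_rpow_of_nonpos (by linarith) (by linarith) (neg_nonpos.2 ha)
    · refine le_of_eq_of_le ?_ (setIntegral_rpow_sub_one_mul_le_negEulerIntegral a hb hx0.le
        (y := x⁻¹) (m := 2 ^ (-a)) ⟨by positivity, inv_le_one_of_one_le₀ hx⟩ fun w hw => ?_)
      · rw [Real.inv_rpow hx0.le, Real.rpow_neg hx0.le b]
        ring
      · have hxw : x * w < 1 := (lt_inv_mul_iff₀ hx0).1 (by simpa using hw.2)
        have hxw0 : 0 < x * w := mul_pos hx0 hw.1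
        exact Real.rpow_le_rpow_of_nonpos (by linarith) (by linarith) (neg_nonpos.2 ha)

lemma negEulerIntegral_le {p : ℝ} (hp : 0 ≤ p) (hpa : p ≤ a) (hpb : p < b) (hx : 0 < x) :
    negEulerIntegral a b x ≤ (b - p)⁻¹ * x ^ (-p) := by
  rw [← setIntegral_rpow_sub_one_mul_rpow hpb hx.le]
  refine setIntegral_mono_on (integrableOn_negEulerIntegrand a (hp.trans_lt hpb) hx.le)
    (integrableOn_rpow_sub_one_mul_rpow hpb hx.le) measurableSet_Ioo fun w hw => ?_
  have hw0 := hw.1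
  gcongr 1
  calc (1 + x * w) ^ (-a) ≤ (1 + x * w) ^ (-p) := by
        gcongr
        exact le_add_of_nonneg_right (by positivity)
    _ ≤ (x * w) ^ (-p) :=
        Real.rpow_le_rpow_of_nonpos (by positivity) (by linarith) (neg_nonpos.2 hp)

end EulerBounds

/-! ### Integrating out the spatial frequency -/

section Marginal

open Set

variable {αt αs αe γt γs γe b : ℝ}

/-- The variable `w = (γₛ² / (γₛ² + y²))^αₛ ∈ (0, 1)` of Euler's integral as a function of the
radial spatial frequency `y > 0`. -/
def eulerVariable (αs γs y : ℝ) : ℝ := (γs ^ 2) ^ αs * (γs ^ 2 + y ^ 2) ^ (-αs)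

lemma hasDerivAt_eulerVariable (hγs : 0 < γs) (αs y : ℝ) :
    HasDerivAt (eulerVariable αs γs)
      (-((γs ^ 2) ^ αs * (2 * y * αs * (γs ^ 2 + y ^ 2) ^ (-αs - 1)))) y := by
  have hbase : HasDerivAt (fun y : ℝ => γs ^ 2 + y ^ 2) (2 * y) y := by
    simpa using (hasDerivAt_pow 2 y).const_add (γs ^ 2)
  have hpow := (hbase.rpow_const (p := -αs) (Or.inl (by positivity))).const_mul ((γs ^ 2) ^ αs)
  exact hpow.congr_deriv (by ring)

lemma strictAntiOn_eulerVariable (hαs : 0 < αs) (hγs : 0 < γs) :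
    StrictAntiOn (eulerVariable αs γs) (Ici 0) := by
  intro y hy y' _ hlt
  have hsq : y ^ 2 < y' ^ 2 := pow_lt_pow_left₀ hlt hy two_ne_zero
  exact mul_lt_mul_of_pos_left (Real.rpow_lt_rpow_of_neg (by positivity) (by linarith)
    (neg_neg_of_pos hαs)) (by positivity)

lemma eulerVariable_zero (hγs : 0 < γs) (αs : ℝ) : eulerVariable αs γs 0 = 1 := by
  rw [eulerVariable, zero_pow two_ne_zero, add_zero, ← Real.rpow_add (by positivity),
    add_neg_cancel, Real.rpow_zero]

lemma image_eulerVariable (hαs : 0 < αs) (hγs : 0 < γs) :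
    eulerVariable αs γs '' Ioi 0 = Ioo 0 1 := by
  have hγ : 0 < γs ^ 2 := by positivity
  refine Subset.antisymm (image_subset_iff.2 fun y hy => ⟨?_, ?_⟩) fun w ⟨hw0, hw1⟩ => ?_
  · rw [eulerVariable]
    positivity
  · rw [← eulerVariable_zero hγs αs]
    exact strictAntiOn_eulerVariable hαs hγs self_mem_Ici (Ioi_subset_Ici_self hy) hy
  · have hpow : 1 < w ^ (-αs⁻¹) := Real.one_lt_rpow_of_pos_of_lt_one_of_neg hw0 hw1 (by simpa)
    have hpos : 0 < γs ^ 2 * (w ^ (-αs⁻¹) - 1) := mul_pos hγ (sub_pos.2 hpow)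
    refine ⟨√(γs ^ 2 * (w ^ (-αs⁻¹) - 1)), Real.sqrt_pos.2 hpos, ?_⟩
    have hsum : γs ^ 2 + γs ^ 2 * (w ^ (-αs⁻¹) - 1) = γs ^ 2 * w ^ (-αs⁻¹) := by ring
    have hexp : -αs⁻¹ * -αs = 1 := by rw [neg_mul_neg, inv_mul_cancel₀ hαs.ne']
    rw [eulerVariable, Real.sq_sqrt hpos.le, hsum, Real.mul_rpow hγ.le (by positivity),
      ← Real.rpow_mul hw0.le, hexp, Real.rpow_one, ← mul_assoc, ← Real.rpow_add hγ,
      add_neg_cancel, Real.rpow_zero, one_mul]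

/-- The radial profile, in the spatial frequency, of the space-time spectrum. -/
def radialProfile (αt αs αe γt γs ωt y : ℝ) : ℝ :=
  (γt ^ 2 * ωt ^ 2 + (γs ^ 2 + y ^ 2) ^ αs) ^ (-αt) * (γs ^ 2 + y ^ 2) ^ (-αe)

lemma one_add_mul_eulerVariable_rpow (hγs : 0 < γs) (αt αs γt ωt y : ℝ) :
    (1 + γt ^ 2 * γs ^ (-2 * αs) * ωt ^ 2 * eulerVariable αs γs y) ^ (-αt) =
      (γt ^ 2 * ωt ^ 2 + (γs ^ 2 + y ^ 2) ^ αs) ^ (-αt) * (γs ^ 2 + y ^ 2) ^ (αs * αt) := by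
  have hv : 0 < γs ^ 2 + y ^ 2 := by positivity
  have hγ : γs ^ (-2 * αs) * (γs ^ 2) ^ αs = 1 := by
    rw [← Real.rpow_natCast, ← Real.rpow_mul hγs.le, ← Real.rpow_add hγs]
    simp
  have hv_cancel : (γs ^ 2 + y ^ 2) ^ αs * (γs ^ 2 + y ^ 2) ^ (-αs) = 1 := by
    rw [← Real.rpow_add hv, add_neg_cancel, Real.rpow_zero]
  have hfactor : 1 + γt ^ 2 * γs ^ (-2 * αs) * ωt ^ 2 * eulerVariable αs γs y =
      (γt ^ 2 * ωt ^ 2 + (γs ^ 2 + y ^ 2) ^ αs) * (γs ^ 2 + y ^ 2) ^ (-αs) := by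
    rw [eulerVariable]
    linear_combination γt ^ 2 * ωt ^ 2 * (γs ^ 2 + y ^ 2) ^ (-αs) * hγ - hv_cancel
  rw [hfactor, Real.mul_rpow (by positivity) (by positivity), ← Real.rpow_mul hv.le, neg_mul_neg]

lemma deriv_eulerVariable_mul_integrand (hαs : 0 < αs) (hγs : 0 < γs) (γt ωt : ℝ)
    (hb : b = (αe - 1) / αs + αt) (y : ℝ) :
    (γs ^ 2) ^ αs * (2 * y * αs * (γs ^ 2 + y ^ 2) ^ (-αs - 1)) *
        (eulerVariable αs γs y ^ (b - 1) *
          (1 + γt ^ 2 * γs ^ (-2 * αs) * ωt ^ 2 * eulerVariable αs γs y) ^ (-αt)) =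
      2 * αs * (γs ^ 2) ^ (αs * b) * (y * radialProfile αt αs αe γt γs ωt y) := by
  have hγ : 0 < γs ^ 2 := by positivity
  have hv : 0 < γs ^ 2 + y ^ 2 := by positivity
  have hexp : -αe = -αs - 1 + -αs * (b - 1) + αs * αt := by
    rw [hb]
    field_simp
    ring
  have hγ_pow : (γs ^ 2) ^ (αs * b) = (γs ^ 2) ^ αs * (γs ^ 2) ^ (αs * (b - 1)) := by
    rw [← Real.rpow_add hγ]
    ring_nf
  rw [one_add_mul_eulerVariable_rpow hγs, radialProfile, hexp, Real.rpow_add hv, Real.rpow_add hv,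
    hγ_pow, eulerVariable, Real.mul_rpow (by positivity) (by positivity), ← Real.rpow_mul hγ.le,
    ← Real.rpow_mul hv.le]
  ring

lemma integrableOn_radialProfile (hαs : 0 < αs) (hγs : 0 < γs) (γt ωt : ℝ)
    (hb : b = (αe - 1) / αs + αt) (hb0 : 0 < b) :
    IntegrableOn (fun y => y * radialProfile αt αs αe γt γs ωt y) (Ioi 0) := by
  have heuler := integrableOn_negEulerIntegrand αt hb0
    (x := γt ^ 2 * γs ^ (-2 * αs) * ωt ^ 2) (by positivity)
  rw [← image_eulerVariable hαs hγs, integrableOn_image_iff_integrableOn_deriv_smul_of_antitoneOn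
    measurableSet_Ioi (fun y _ => (hasDerivAt_eulerVariable hγs αs y).hasDerivWithinAt)
    ((strictAntiOn_eulerVariable hαs hγs).antitoneOn.mono Ioi_subset_Ici_self)] at heuler
  simp only [neg_neg, smul_eq_mul, deriv_eulerVariable_mul_integrand hαs hγs γt ωt hb] at heuler
  exact (integrable_const_mul_iff (IsUnit.mk0 _ (by positivity)) _).1 heuler

lemma setIntegral_radialProfile (hαs : 0 < αs) (hγs : 0 < γs) (γt ωt : ℝ)
    (hb : b = (αe - 1) / αs + αt) :
    ∫ y in Ioi 0, y * radialProfile αt αs αe γt γs ωt y =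
      (2 * αs * (γs ^ 2) ^ (αs * b))⁻¹ *
        negEulerIntegral αt b (γt ^ 2 * γs ^ (-2 * αs) * ωt ^ 2) := by
  rw [negEulerIntegral, ← image_eulerVariable hαs hγs,
    integral_image_eq_integral_deriv_smul_of_antitoneOn measurableSet_Ioi
      (fun y _ => (hasDerivAt_eulerVariable hγs αs y).hasDerivWithinAt)
      ((strictAntiOn_eulerVariable hαs hγs).antitoneOn.mono Ioi_subset_Ici_self)]
  simp only [neg_neg, smul_eq_mul, deriv_eulerVariable_mul_integrand hαs hγs γt ωt hb]
  rw [integral_const_mul, inv_mul_cancel_left₀ (by positivity)]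

lemma fieldSpectrum_toLp (αt αs αe γt γs γe ωt : ℝ) (ωs : Space) :
    fieldSpectrum αt αs αe γt γs γe (WithLp.toLp 2 (ωs, ωt)) =
      ((2 * Real.pi) ^ 3)⁻¹ * (γe ^ 2)⁻¹ * radialProfile αt αs αe γt γs ωt ‖ωs‖ := rfl

lemma integrable_fieldSpectrum_slice (hαs : 0 < αs) (hγs : 0 < γs) (γt γe ωt : ℝ)
    (hb : b = (αe - 1) / αs + αt) (hb0 : 0 < b) :
    Integrable fun ωs : Space => fieldSpectrum αt αs αe γt γs γe (WithLp.toLp 2 (ωs, ωt)) := by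
  simp_rw [fieldSpectrum_toLp]
  refine Integrable.const_mul ?_ _
  rw [integrable_fun_norm_addHaar volume (f := radialProfile αt αs αe γt γs ωt)]
  simpa using integrableOn_radialProfile hαs hγs γt ωt hb hb0

/-- The marginal temporal spectrum of the solution. -/
def marginalSpectrum (αt αs αe γt γs γe ωt : ℝ) : ℝ :=
  ∫ ωs : Space, fieldSpectrum αt αs αe γt γs γe (WithLp.toLp 2 (ωs, ωt))

theorem exists_marginalSpectrum_eq_negEulerIntegral (hαs : 0 < αs) (hγs : 0 < γs) (hγe : γe ≠ 0)
    (γt : ℝ) (hb : b = (αe - 1) / αs + αt) :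
    ∃ C : ℝ, 0 < C ∧ ∀ ωt, marginalSpectrum αt αs αe γt γs γe ωt =
      C * negEulerIntegral αt b (γt ^ 2 * γs ^ (-2 * αs) * ωt ^ 2) := by
  have hball : 0 < volume.real (Metric.ball (0 : Space) 1) :=
    ENNReal.toReal_pos (Metric.measure_ball_pos volume 0 one_pos).ne' measure_ball_lt_top.ne
  refine ⟨((2 * Real.pi) ^ 3)⁻¹ * (γe ^ 2)⁻¹ * (2 * volume.real (Metric.ball (0 : Space) 1) *
    (2 * αs * (γs ^ 2) ^ (αs * b))⁻¹), by positivity, fun ωt => ?_⟩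
  have hpolar : ∫ ωs : Space, radialProfile αt αs αe γt γs ωt ‖ωs‖ =
      2 * volume.real (Metric.ball (0 : Space) 1) *
        ∫ y in Ioi 0, y * radialProfile αt αs αe γt γs ωt y := by
    simpa [mul_assoc] using
      integral_fun_norm_addHaar (volume : Measure Space) (radialProfile αt αs αe γt γs ωt)
  simp_rw [marginalSpectrum, fieldSpectrum_toLp]
  rw [integral_const_mul, hpolar, setIntegral_radialProfile hαs hγs γt ωt hb]
  ring

end Marginal

/-! ### Approximate point evaluations -/

section Mollifier

open Filter
open scoped Convolution

section

variable {V : Type*} [NormedAddCommGroup V]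

/-- A bump function at the origin with support of radius `1 / (n + 1)`. -/
def shrinkingBump (V : Type*) [NormedAddCommGroup V] (n : ℕ) : ContDiffBump (0 : V) where
  rIn := 1 / (n + 1) / 2
  rOut := 1 / (n + 1)
  rIn_pos := by positivity
  rIn_lt_rOut := half_lt_self (by positivity)

variable [InnerProductSpace ℝ V] [FiniteDimensional ℝ V] [MeasurableSpace V] [BorelSpace V]

/-- A nonnegative test function of integral one supported in the ball of radius `1 / (n + 1)` about
`x`: an approximation of the evaluation at `x`. -/
def mollifier (x : V) (n : ℕ) : 𝓢(V, ℝ) :=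
  HasCompactSupport.toSchwartzMap (f := fun y => (shrinkingBump V n).normed volume (x - y))
    ((shrinkingBump V n).hasCompactSupport_normed.comp_homeomorph (Homeomorph.subLeft x))
    ((shrinkingBump V n).contDiff_normed.comp (contDiff_const.sub contDiff_id))

lemma mollifier_apply (x : V) (n : ℕ) (y : V) :
    mollifier x n y = (shrinkingBump V n).normed volume (x - y) := rfl

lemma integral_norm_mollifier (x : V) (n : ℕ) : ∫ y, ‖mollifier x n y‖ = 1 := by
  simp_rw [mollifier_apply, Real.norm_of_nonneg ((shrinkingBump V n).nonneg_normed _)]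
  rw [integral_sub_left_eq_self (fun y => (shrinkingBump V n).normed volume y) volume x]
  exact (shrinkingBump V n).integral_normed

lemma tendsto_integral_mollifier_smul {F : Type*} [NormedAddCommGroup F] [NormedSpace ℝ F]
    [CompleteSpace F] (x : V) {g : V → F} (hg : Continuous g) :
    Tendsto (fun n => ∫ y, mollifier x n y • g y) atTop (𝓝 (g x)) := by
  refine (ContDiffBump.convolution_tendsto_right_of_continuous (μ := volume)
    (φ := shrinkingBump V) tendsto_one_div_add_atTop_nhds_zero_nat hg x).congr fun n => ?_
  simp_rw [convolution_lsmul_swap, mollifier_apply]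

end

lemma angularFourier_eq_integral (f : SpaceTime → ℝ) (ω : SpaceTime) :
    angularFourier f ω = ∫ y, f y • Complex.exp (Complex.I * (-inner ℝ ω y : ℝ)) := by
  rw [angularFourier, Real.fourier_eq]
  congr 1 with y
  rw [Circle.smul_def, Real.fourierChar_apply, Complex.real_smul, smul_eq_mul, mul_comm,
    real_inner_smul_right, real_inner_comm, mul_comm Complex.I]
  congr 4
  field_simp

lemma norm_angularFourier_le_integral_norm (f : SpaceTime → ℝ) (ω : SpaceTime) :
    ‖angularFourier f ω‖ ≤ ∫ y, ‖f y‖ := by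
  rw [angularFourier_eq_integral]
  refine (norm_integral_le_integral_norm _).trans_eq ?_
  simp_rw [norm_smul, Complex.norm_exp_I_mul_ofReal, mul_one]

lemma norm_angularFourier_mollifier_le (x : SpaceTime) (n : ℕ) (ω : SpaceTime) :
    ‖angularFourier (mollifier x n) ω‖ ≤ 1 :=
  (norm_angularFourier_le_integral_norm _ ω).trans_eq (integral_norm_mollifier x n)

lemma tendsto_angularFourier_mollifier (x ω : SpaceTime) :
    Tendsto (fun n => angularFourier (mollifier x n) ω) atTop
      (𝓝 (Complex.exp (Complex.I * (-inner ℝ ω x : ℝ)))) := by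
  simp_rw [angularFourier_eq_integral]
  exact tendsto_integral_mollifier_smul x
    (g := fun y => Complex.exp (Complex.I * (-inner ℝ ω y : ℝ))) (by fun_prop)

end Mollifier

/-! ### Covariance of a pointwise version -/

section PointwiseVersion

open Filter

variable {Ω : Type*} [MeasurableSpace Ω] {P : Measure Ω}

lemma integral_eq_inner_one [IsFiniteMeasure P] (Z : Lp ℝ 2 P) :
    ∫ w, Z w ∂P = inner ℝ ((memLp_const (1 : ℝ)).toLp (fun _ : Ω => (1 : ℝ)) : Lp ℝ 2 P) Z := by
  rw [L2.inner_def]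
  refine integral_congr_ae ?_
  filter_upwards [(memLp_const (1 : ℝ) : MemLp (fun _ : Ω => (1 : ℝ)) 2 P).coeFn_toLp] with w hw
  rw [hw]
  simp

lemma covariance_eq_inner {X Y : Ω → ℝ} {A B : Lp ℝ 2 P} (hX : X =ᵐ[P] A) (hY : Y =ᵐ[P] B)
    (hX0 : ∫ w, X w ∂P = 0) (hY0 : ∫ w, Y w ∂P = 0) : cov[X, Y; P] = inner ℝ A B := by
  rw [covariance, hX0, hY0, L2.inner_def]
  refine integral_congr_ae ?_
  filter_upwards [hX, hY] with w hXw hYw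
  simp [hXw, hYw, mul_comm]

variable {u : 𝓢(SpaceTime, ℝ) → Ω → ℝ} {U : Space → ℝ → Ω → ℝ} {S : SpaceTime → ℝ}

namespace IsSpectrum

variable (hS : IsSpectrum P u S) (φ : 𝓢(SpaceTime, ℝ))

include hS

lemma lintegral_norm_angularFourier_sq_mul :
    ∫⁻ ω, ENNReal.ofReal (‖angularFourier φ ω‖ ^ 2 * S ω) =
      ENNReal.ofReal (cov[u φ, u φ; P]) := by
  have hsq (ω : SpaceTime) : (starRingEnd ℂ) (angularFourier φ ω) * angularFourier φ ω * (S ω : ℂ) =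
      ((‖angularFourier φ ω‖ ^ 2 * S ω : ℝ) : ℂ) := by
    rw [← Complex.normSq_eq_conj_mul_self, Complex.normSq_eq_norm_sq, Complex.ofReal_mul]
  have hint := hS.integrable φ φ
  have hcov := hS.covariance_eq φ φ
  simp_rw [hsq] at hint hcov
  rw [integral_complex_ofReal, Complex.ofReal_inj] at hcov
  rw [hcov, ofReal_integral_eq_lintegral_ofReal]
  · simpa only [RCLike.re_eq_complex_re, Complex.ofReal_re] using hint.re
  · exact Eventually.of_forall fun ω => mul_nonneg (sq_nonneg _) (hS.nonneg ω)

lemma measurable_norm_angularFourier_sq_mul :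
    Measurable fun ω => ENNReal.ofReal (‖angularFourier φ ω‖ ^ 2 * S ω) :=
  (((continuous_angularFourier φ).norm.pow 2).measurable.mul hS.measurable).ennreal_ofReal

end IsSpectrum

namespace IsPointwiseVersion

/-- A pointwise version as a map to `L²`. -/
def curve (hU : IsPointwiseVersion P u U) (x : SpaceTime) : Lp ℝ 2 P :=
  (hU.memLp x.fst x.snd).toLp (U x.fst x.snd)

/-- The average of a pointwise version against a test function. -/
def average (hU : IsPointwiseVersion P u U) (φ : 𝓢(SpaceTime, ℝ)) : Lp ℝ 2 P :=
  ∫ x, φ x • hU.curve x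

lemma tendsto_average_mollifier (hU : IsPointwiseVersion P u U) (x : SpaceTime) :
    Tendsto (fun n => hU.average (mollifier x n)) atTop (𝓝 (hU.curve x)) :=
  tendsto_integral_mollifier_smul x hU.continuous

lemma integral_eq_zero [IsFiniteMeasure P] (hU : IsPointwiseVersion P u U)
    (hu : ∀ φ, ∫ w, u φ w ∂P = 0) (s : Space) (t : ℝ) : ∫ w, U s t w ∂P = 0 := by
  rw [integral_congr_ae (hU.memLp s t).coeFn_toLp.symm, integral_eq_inner_one]
  refine tendsto_nhds_unique
    (tendsto_const_nhds.inner (hU.tendsto_average_mollifier (WithLp.toLp 2 (s, t))))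
    (tendsto_const_nhds.congr fun n => ?_)
  rw [← integral_eq_inner_one, ← hu (mollifier (WithLp.toLp 2 (s, t)) n)]
  exact integral_congr_ae (hU.eq_integral _)

lemma covariance_eq_inner_curve [IsFiniteMeasure P] (hU : IsPointwiseVersion P u U)
    (hu : ∀ φ, ∫ w, u φ w ∂P = 0) (s s' : Space) (t t' : ℝ) :
    cov[U s t, U s' t'; P] =
      inner ℝ (hU.curve (WithLp.toLp 2 (s, t))) (hU.curve (WithLp.toLp 2 (s', t'))) :=
  covariance_eq_inner (hU.memLp s t).coeFn_toLp.symm (hU.memLp s' t').coeFn_toLp.symm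
    (hU.integral_eq_zero hu s t) (hU.integral_eq_zero hu s' t')

lemma tendsto_covariance_mollifier (hU : IsPointwiseVersion P u U)
    (hu : ∀ φ, ∫ w, u φ w ∂P = 0) (x y : SpaceTime) :
    Tendsto (fun n => cov[u (mollifier x n), u (mollifier y n); P]) atTop
      (𝓝 (inner ℝ (hU.curve x) (hU.curve y))) :=
  ((hU.tendsto_average_mollifier x).inner (hU.tendsto_average_mollifier y)).congr fun _ =>
    (covariance_eq_inner (hU.eq_integral _) (hU.eq_integral _) (hu _) (hu _)).symm

-- Fatou's lemma along mollifiers at the origin bounds the total mass of `S` by `‖U(0)‖²`.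
lemma integrable_spectrum (hU : IsPointwiseVersion P u U) (hu : ∀ φ, ∫ w, u φ w ∂P = 0)
    (hS : IsSpectrum P u S) : Integrable S := by
  refine ⟨hS.measurable.aestronglyMeasurable, ?_⟩
  set f : ℕ → SpaceTime → ℝ≥0∞ := fun n ω =>
    ENNReal.ofReal (‖angularFourier (mollifier 0 n) ω‖ ^ 2 * S ω)
  have hlim (ω : SpaceTime) : Tendsto (fun n => f n ω) atTop (𝓝 (ENNReal.ofReal (S ω))) := by
    refine ENNReal.tendsto_ofReal ?_
    simpa only [Complex.norm_exp_I_mul_ofReal, one_pow, one_mul] using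
      ((tendsto_angularFourier_mollifier 0 ω).norm.pow 2).mul_const (S ω)
  rw [hasFiniteIntegral_iff_ofReal (Eventually.of_forall hS.nonneg)]
  calc ∫⁻ ω, ENNReal.ofReal (S ω) = ∫⁻ ω, liminf (fun n => f n ω) atTop :=
        lintegral_congr fun ω => (hlim ω).liminf_eq.symm
    _ ≤ liminf (fun n => ∫⁻ ω, f n ω) atTop :=
        lintegral_liminf_le fun _ => hS.measurable_norm_angularFourier_sq_mul _
    _ = ENNReal.ofReal (inner ℝ (hU.curve 0) (hU.curve 0)) := by
        simp_rw [f, hS.lintegral_norm_angularFourier_sq_mul]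
        exact (ENNReal.tendsto_ofReal (hU.tendsto_covariance_mollifier hu 0 0)).liminf_eq
    _ < ∞ := ENNReal.ofReal_lt_top

theorem inner_curve_eq_integral (hU : IsPointwiseVersion P u U) (hu : ∀ φ, ∫ w, u φ w ∂P = 0)
    (hS : IsSpectrum P u S) (x y : SpaceTime) :
    ((inner ℝ (hU.curve x) (hU.curve y) : ℝ) : ℂ) =
      ∫ ω, Complex.exp (Complex.I * (inner ℝ ω (x - y) : ℝ)) * (S ω : ℂ) := by
  have hcov : Tendsto (fun n => ((cov[u (mollifier x n), u (mollifier y n); P] : ℝ) : ℂ)) atTop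
      (𝓝 ((inner ℝ (hU.curve x) (hU.curve y) : ℝ) : ℂ)) :=
    (Complex.continuous_ofReal.tendsto _).comp (hU.tendsto_covariance_mollifier hu x y)
  have hlim (ω : SpaceTime) : Tendsto (fun n => (starRingEnd ℂ) (angularFourier (mollifier x n) ω) *
      angularFourier (mollifier y n) ω) atTop
        (𝓝 (Complex.exp (Complex.I * (inner ℝ ω (x - y) : ℝ)))) := by
    convert ((Complex.continuous_conj.tendsto _).comp
      (tendsto_angularFourier_mollifier x ω)).mul (tendsto_angularFourier_mollifier y ω) using 2
    · rfl
    · rw [← Complex.exp_conj, ← Complex.exp_add, inner_sub_right, map_mul, Complex.conj_I,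
        Complex.conj_ofReal]
      congr 1
      push_cast
      ring
  refine tendsto_nhds_unique hcov ?_
  simp_rw [hS.covariance_eq]
  refine tendsto_integral_of_dominated_convergence S
    (fun n => (hS.integrable _ _).aestronglyMeasurable) (hU.integrable_spectrum hu hS)
    (fun n => Eventually.of_forall fun ω => ?_)
    (Eventually.of_forall fun ω => (hlim ω).mul_const _)
  rw [norm_mul, norm_mul, RCLike.norm_conj, Complex.norm_real, Real.norm_of_nonneg (hS.nonneg ω)]
  exact mul_le_of_le_one_left (hS.nonneg ω) (mul_le_one₀
    (norm_angularFourier_mollifier_le x n ω) (norm_nonneg _)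
    (norm_angularFourier_mollifier_le y n ω))

theorem isProcessSpectrum [IsFiniteMeasure P] (hU : IsPointwiseVersion P u U)
    (hu : ∀ φ, ∫ w, u φ w ∂P = 0) (hS : IsSpectrum P u S) (s : Space) :
    IsProcessSpectrum P (U s) (fun ωt => ∫ ωs : Space, S (WithLp.toLp 2 (ωs, ωt))) := by
  have hpres := WithLp.volume_preserving_toLp Space ℝ
  have hemb : MeasurableEmbedding (@WithLp.toLp 2 (Space × ℝ)) :=
    (MeasurableEquiv.toLp 2 (Space × ℝ)).measurableEmbedding
  have hSprod : Integrable (fun p : Space × ℝ => S (WithLp.toLp 2 p)) (volume.prod volume) :=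
    (hpres.integrable_comp_emb hemb).2 (hU.integrable_spectrum hu hS)
  refine ⟨fun ωt => integral_nonneg fun ωs => hS.nonneg _, hSprod.integral_prod_right,
    fun t₁ t₂ => ?_⟩
  have hphase (p : Space × ℝ) : inner ℝ (WithLp.toLp 2 p : SpaceTime)
      (WithLp.toLp 2 (s, t₁) - WithLp.toLp 2 (s, t₂)) = p.2 * (t₁ - t₂) := by
    simp [WithLp.prod_inner_apply, mul_comm]
  have hint : Integrable (fun p : Space × ℝ => Complex.exp (Complex.I * (p.2 * (t₁ - t₂) : ℝ)) *
      (S (WithLp.toLp 2 p) : ℂ)) (volume.prod volume) :=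
    hSprod.ofReal.bdd_mul (c := 1) (Continuous.aestronglyMeasurable (by fun_prop))
      (Eventually.of_forall fun p => (Complex.norm_exp_I_mul_ofReal _).le)
  rw [hU.covariance_eq_inner_curve hu, hU.inner_curve_eq_integral hu hS, ← hpres.integral_comp hemb]
  simp_rw [hphase]
  rw [Measure.volume_eq_prod, integral_prod_symm _ hint]
  congr 1 with ωt
  rw [← integral_complex_ofReal, ← integral_const_mul]

end IsPointwiseVersion

end PointwiseVersion

/-! ### Curves with a spectral density -/

section Wave

open scoped BoundedContinuousFunction

/-- The oscillation `ω ↦ exp(iωt)`, as an element of the space of bounded continuous functions. -/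
def wave (t : ℝ) : ℝ →ᵇ ℂ :=
  .ofNormedAddCommGroup (fun ω => Complex.exp (Complex.I * (ω * t : ℝ))) (by fun_prop) 1
    fun ω => (Complex.norm_exp_I_mul_ofReal (ω * t)).le

lemma wave_apply (t ω : ℝ) : wave t ω = Complex.exp (Complex.I * (ω * t : ℝ)) := rfl

lemma norm_wave (t ω : ℝ) : ‖wave t ω‖ = 1 :=
  Complex.norm_exp_I_mul_ofReal (ω * t)

lemma wave_add (s t ω : ℝ) : wave (s + t) ω = wave s ω * wave t ω := by
  rw [wave_apply, wave_apply, wave_apply, ← Complex.exp_add, ← mul_add, ← Complex.ofReal_add,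
    mul_add]

lemma conj_wave (t ω : ℝ) : (starRingEnd ℂ) (wave t ω) = wave (-t) ω := by
  rw [wave_apply, wave_apply, ← Complex.exp_conj]
  simp

lemma wave_mul_conj_wave (s t ω : ℝ) :
    wave s ω * (starRingEnd ℂ) (wave t ω) = wave (s - t) ω := by
  rw [conj_wave, ← wave_add, sub_eq_add_neg]

lemma norm_wave_sub_wave_le (s t ω : ℝ) : ‖wave s ω - wave t ω‖ ≤ |ω| * |s - t| := by
  calc ‖wave s ω - wave t ω‖ = ‖wave t ω * (wave (s - t) ω - 1)‖ := by
        rw [mul_sub, ← wave_add, mul_one, add_sub_cancel]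
    _ = ‖wave (s - t) ω - 1‖ := by rw [norm_mul, norm_wave, one_mul]
    _ ≤ |ω| * |s - t| := by
        rw [← abs_mul]
        exact Real.norm_exp_I_mul_ofReal_sub_one_le

lemma norm_wave_sub_wave_le_two (s t ω : ℝ) : ‖wave s ω - wave t ω‖ ≤ 2 := by
  refine (norm_sub_le _ _).trans_eq ?_
  rw [norm_wave, norm_wave, one_add_one_eq_two]

lemma norm_wave_sub_wave_le_rpow {θ : ℝ} (hθ : 0 ≤ θ) (hθ1 : θ ≤ 1) (s t ω : ℝ) :
    ‖wave s ω - wave t ω‖ ≤ 2 * (|ω| * |s - t|) ^ θ := by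
  set x := |ω| * |s - t|
  have hx : 0 ≤ x := by positivity
  have hxθ : 0 ≤ x ^ θ := Real.rpow_nonneg hx θ
  rcases le_total x 1 with hx1 | hx1
  · calc ‖wave s ω - wave t ω‖ ≤ x := norm_wave_sub_wave_le s t ω
      _ ≤ x ^ θ := Real.self_le_rpow_of_le_one hx hx1 hθ1
      _ ≤ 2 * x ^ θ := by linarith
  · calc ‖wave s ω - wave t ω‖ ≤ 2 := norm_wave_sub_wave_le_two s t ω
      _ ≤ 2 * x ^ θ := by linarith [Real.one_le_rpow hx1 hθ]

lemma hasDerivAt_wave (t ω : ℝ) :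
    HasDerivAt (fun t => wave t ω) (Complex.I * ω * wave t ω) t := by
  have hphase : HasDerivAt (fun t : ℝ => Complex.I * ((ω * t : ℝ) : ℂ)) (Complex.I * ω) t := by
    simpa using ((hasDerivAt_id t).const_mul ω).ofReal_comp.const_mul Complex.I
  have hexp := hphase.cexp
  rwa [mul_comm] at hexp

lemma inv_pi_le_norm_wave_sub_one {t ω : ℝ} (hωt : 1 / 2 ≤ ω * t) (hωt1 : ω * t ≤ 1) :
    Real.pi⁻¹ ≤ ‖wave t ω - 1‖ := by
  have him : (wave t ω - 1).im = Real.sin (ω * t) := by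
    rw [wave_apply, mul_comm, Complex.sub_im, Complex.exp_ofReal_mul_I_im, Complex.one_im,
      sub_zero]
  calc Real.pi⁻¹ = 2 / Real.pi * (1 / 2) := by ring
    _ ≤ 2 / Real.pi * (ω * t) := by gcongr
    _ ≤ Real.sin (ω * t) := Real.mul_le_sin (by linarith) (by linarith [Real.pi_gt_three])
    _ = (wave t ω - 1).im := him.symm
    _ ≤ ‖wave t ω - 1‖ := (le_abs_self _).trans (Complex.abs_im_le_norm _)

end Wave

section SpectralCurve

open Filter
open scoped BoundedContinuousFunction

variable {H : Type*} [NormedAddCommGroup H] [InnerProductSpace ℝ H]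

lemma mul_conj_mul_eq_norm_sq_mul (z : ℂ) (r : ℝ) :
    z * (starRingEnd ℂ) z * r = ((‖z‖ ^ 2 * r : ℝ) : ℂ) := by
  rw [Complex.mul_conj, Complex.normSq_eq_norm_sq, Complex.ofReal_mul]

/-- `S` is a spectral density of the curve `X`: `⟪X s, X t⟫ = ∫ exp(iω(s - t)) S(ω) dω`. -/
structure HasSpectralDensity (X : ℝ → H) (S : ℝ → ℝ) : Prop where
  nonneg : ∀ ω, 0 ≤ S ω
  integrable : Integrable S
  inner_eq : ∀ s t, ((inner ℝ (X s) (X t) : ℝ) : ℂ) = ∫ ω, wave (s - t) ω * (S ω : ℂ)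

/-- The curve together with its spectral image `t ↦ exp(iωt)`. -/
def spectralGraph (X : ℝ → H) (t : ℝ) : H × (ℝ →ᵇ ℂ) := (X t, wave t)

/-- Finite real linear combinations of values of the curve, together with their spectral images.
This encodes the spectral isometry `X t ↦ exp(iωt)` as a linear relation, so that it need not be
checked to be well defined. -/
def spectralSpan (X : ℝ → H) : Submodule ℝ (H × (ℝ →ᵇ ℂ)) :=
  Submodule.span ℝ (Set.range (spectralGraph X))

variable {X : ℝ → H} {S : ℝ → ℝ}

lemma spectralGraph_mem (X : ℝ → H) (t : ℝ) : spectralGraph X t ∈ spectralSpan X :=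
  Submodule.subset_span ⟨t, rfl⟩

/-- The difference quotient of the curve, together with its spectral image. -/
def spectralSlope (X : ℝ → H) (t h : ℝ) : H × (ℝ →ᵇ ℂ) :=
  h⁻¹ • (spectralGraph X (t + h) - spectralGraph X t)

lemma spectralSlope_mem (X : ℝ → H) (t h : ℝ) : spectralSlope X t h ∈ spectralSpan X :=
  Submodule.smul_mem _ _ (sub_mem (spectralGraph_mem X _) (spectralGraph_mem X _))

lemma spectralSlope_snd (X : ℝ → H) (t h ω : ℝ) :
    (spectralSlope X t h).2 ω = h⁻¹ • (wave (t + h) ω - wave t ω) := rfl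

lemma tendsto_spectralSlope_snd (X : ℝ → H) (t ω : ℝ) :
    Tendsto (fun h => (spectralSlope X t h).2 ω) (𝓝[≠] 0) (𝓝 (Complex.I * ω * wave t ω)) := by
  simp_rw [spectralSlope_snd]
  exact (hasDerivAt_wave t ω).tendsto_slope_zero

lemma norm_spectralSlope_snd_le (X : ℝ → H) (t h ω : ℝ) :
    ‖(spectralSlope X t h).2 ω‖ ≤ |ω| := by
  rw [spectralSlope_snd, norm_smul, norm_inv, Real.norm_eq_abs]
  refine inv_mul_le_of_le_mul₀ (abs_nonneg h) (abs_nonneg ω) ?_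
  simpa only [add_sub_cancel_left, mul_comm] using norm_wave_sub_wave_le (t + h) t ω

namespace HasSpectralDensity

lemma integrable_mul_conj_mul (hX : HasSpectralDensity X S) (f g : ℝ →ᵇ ℂ) :
    Integrable fun ω => f ω * (starRingEnd ℂ) (g ω) * (S ω : ℂ) := by
  refine hX.integrable.ofReal.bdd_mul (c := ‖f‖ * ‖g‖)
    (f.continuous.mul (Complex.continuous_conj.comp g.continuous)).aestronglyMeasurable
    (Eventually.of_forall fun ω => ?_)
  rw [norm_mul, RCLike.norm_conj]
  gcongr
  · exact f.norm_coe_le_norm ω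
  · exact g.norm_coe_le_norm ω

theorem inner_eq_integral (hX : HasSpectralDensity X S) {p q : H × (ℝ →ᵇ ℂ)}
    (hp : p ∈ spectralSpan X) (hq : q ∈ spectralSpan X) :
    ((inner ℝ p.1 q.1 : ℝ) : ℂ) = ∫ ω, p.2 ω * (starRingEnd ℂ) (q.2 ω) * (S ω : ℂ) := by
  have hint := hX.integrable_mul_conj_mul
  induction hp, hq using Submodule.span_induction₂ with
  | mem_mem p q hp hq =>
    obtain ⟨s, rfl⟩ := hp
    obtain ⟨t, rfl⟩ := hq
    simp_rw [spectralGraph, hX.inner_eq, wave_mul_conj_wave]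
  | zero_left q _ => simp
  | zero_right p _ => simp
  | add_left p q r _ _ _ hp hq =>
    simp only [Prod.fst_add, Prod.snd_add, BoundedContinuousFunction.coe_add, Pi.add_apply,
      inner_add_left, Complex.ofReal_add, hp, hq, add_mul, integral_add (hint _ _) (hint _ _)]
  | add_right p q r _ _ _ hp hq =>
    simp only [Prod.fst_add, Prod.snd_add, BoundedContinuousFunction.coe_add, Pi.add_apply,
      inner_add_right, Complex.ofReal_add, hp, hq, map_add, mul_add, add_mul,
      integral_add (hint _ _) (hint _ _)]
  | smul_left r p q _ _ h =>
    simp only [Prod.smul_fst, Prod.smul_snd, BoundedContinuousFunction.coe_smul, inner_smul_left,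
      Complex.ofReal_mul, h, Complex.real_smul, conj_trivial, mul_assoc, integral_const_mul]
  | smul_right r p q _ _ h =>
    simp only [Prod.smul_fst, Prod.smul_snd, BoundedContinuousFunction.coe_smul, inner_smul_right,
      Complex.ofReal_mul, h, Complex.real_smul, map_mul, Complex.conj_ofReal, mul_assoc,
      mul_left_comm _ (r : ℂ), integral_const_mul]

lemma integrable_norm_sq_mul (hX : HasSpectralDensity X S) (f : ℝ →ᵇ ℂ) :
    Integrable fun ω => ‖f ω‖ ^ 2 * S ω := by
  have hint := hX.integrable_mul_conj_mul f f
  simp_rw [mul_conj_mul_eq_norm_sq_mul] at hint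
  simpa only [RCLike.re_eq_complex_re, Complex.ofReal_re] using hint.re

lemma norm_sq_eq_integral (hX : HasSpectralDensity X S) {p : H × (ℝ →ᵇ ℂ)}
    (hp : p ∈ spectralSpan X) : ‖p.1‖ ^ 2 = ∫ ω, ‖p.2 ω‖ ^ 2 * S ω := by
  have hinner := hX.inner_eq_integral hp hp
  simp_rw [mul_conj_mul_eq_norm_sq_mul] at hinner
  rwa [integral_complex_ofReal, Complex.ofReal_inj, real_inner_self_eq_norm_sq] at hinner

section Limit

variable {ι : Type*} {l : Filter ι} [l.IsCountablyGenerated] {p q : ι → H × (ℝ →ᵇ ℂ)} {B : ℝ → ℝ}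

lemma tendsto_inner (hX : HasSpectralDensity X S) (hp : ∀ i, p i ∈ spectralSpan X)
    (hq : ∀ i, q i ∈ spectralSpan X) {f g : ℝ → ℂ}
    (hpf : ∀ ω, Tendsto (fun i => (p i).2 ω) l (𝓝 (f ω)))
    (hqg : ∀ ω, Tendsto (fun i => (q i).2 ω) l (𝓝 (g ω)))
    (hpB : ∀ i ω, ‖(p i).2 ω‖ ≤ B ω) (hqB : ∀ i ω, ‖(q i).2 ω‖ ≤ B ω)
    (hB : Integrable fun ω => B ω ^ 2 * S ω) :
    Tendsto (fun i => ((inner ℝ (p i).1 (q i).1 : ℝ) : ℂ)) l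
      (𝓝 (∫ ω, f ω * (starRingEnd ℂ) (g ω) * (S ω : ℂ))) := by
  simp_rw [fun i => hX.inner_eq_integral (hp i) (hq i)]
  refine tendsto_integral_filter_of_dominated_convergence _
    (Eventually.of_forall fun _ => (hX.integrable_mul_conj_mul _ _).aestronglyMeasurable)
    (Eventually.of_forall fun i => Eventually.of_forall fun ω => ?_) hB
    (Eventually.of_forall fun ω =>
      ((hpf ω).mul ((Complex.continuous_conj.tendsto _).comp (hqg ω))).mul_const _)
  rw [norm_mul, norm_mul, RCLike.norm_conj, Complex.norm_real, Real.norm_of_nonneg (hX.nonneg ω),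
    sq]
  exact mul_le_mul_of_nonneg_right (mul_le_mul (hpB i ω) (hqB i ω) (norm_nonneg _)
    ((norm_nonneg _).trans (hpB i ω))) (hX.nonneg ω)

lemma tendsto_zero (hX : HasSpectralDensity X S) (hp : ∀ i, p i ∈ spectralSpan X)
    (hp0 : ∀ ω, Tendsto (fun i => (p i).2 ω) l (𝓝 0)) (hpB : ∀ i ω, ‖(p i).2 ω‖ ≤ B ω)
    (hB : Integrable fun ω => B ω ^ 2 * S ω) : Tendsto (fun i => (p i).1) l (𝓝 0) := by
  have hinner := (Complex.continuous_re.tendsto _).comp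
    (hX.tendsto_inner hp hp (f := 0) (g := 0) hp0 hp0 hpB hpB hB)
  simp only [Function.comp_def, Pi.zero_apply, zero_mul, integral_zero, Complex.zero_re,
    Complex.ofReal_re, real_inner_self_eq_norm_sq] at hinner
  rw [tendsto_zero_iff_norm_tendsto_zero]
  simpa only [Real.sqrt_sq (norm_nonneg _), Real.sqrt_zero] using hinner.sqrt

end Limit

protected lemma continuous (hX : HasSpectralDensity X S) : Continuous X := by
  refine continuous_iff_continuousAt.2 fun t => tendsto_sub_nhds_zero_iff.1 ?_
  refine hX.tendsto_zero (p := fun s => spectralGraph X s - spectralGraph X t) (B := fun _ => 2)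
    (fun s => sub_mem (spectralGraph_mem X s) (spectralGraph_mem X t)) (fun ω => ?_)
    (fun s ω => norm_wave_sub_wave_le_two s t ω) (hX.integrable.const_mul _)
  exact tendsto_sub_nhds_zero_iff.2 (hasDerivAt_wave t ω).continuousAt.tendsto

protected lemma norm_sub_le (hX : HasSpectralDensity X S) {θ : ℝ} (hθ : 0 ≤ θ) (hθ1 : θ ≤ 1)
    (hint : Integrable fun ω => |ω| ^ (2 * θ) * S ω) (s t : ℝ) :
    ‖X s - X t‖ ≤ 2 * √(∫ ω, |ω| ^ (2 * θ) * S ω) * |s - t| ^ θ := by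
  have hmoment : 0 ≤ ∫ ω, |ω| ^ (2 * θ) * S ω :=
    integral_nonneg fun ω => mul_nonneg (Real.rpow_nonneg (abs_nonneg _) _) (hX.nonneg ω)
  have hwave (ω : ℝ) : ‖wave s ω - wave t ω‖ ^ 2 ≤ 4 * (|ω| ^ (2 * θ) * (|s - t| ^ θ) ^ 2) := by
    calc ‖wave s ω - wave t ω‖ ^ 2 ≤ (2 * (|ω| * |s - t|) ^ θ) ^ 2 := by
          gcongr
          exact norm_wave_sub_wave_le_rpow hθ hθ1 s t ω
      _ = 4 * (|ω| ^ (2 * θ) * (|s - t| ^ θ) ^ 2) := by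
          rw [Real.mul_rpow (abs_nonneg _) (abs_nonneg _), mul_comm 2 θ,
            Real.rpow_mul (abs_nonneg ω), Real.rpow_two]
          ring
  rw [← pow_le_pow_iff_left₀ (norm_nonneg _) (by positivity) two_ne_zero]
  calc ‖X s - X t‖ ^ 2 = ∫ ω, ‖wave s ω - wave t ω‖ ^ 2 * S ω :=
        hX.norm_sq_eq_integral (sub_mem (spectralGraph_mem X s) (spectralGraph_mem X t))
    _ ≤ ∫ ω, 4 * (|s - t| ^ θ) ^ 2 * (|ω| ^ (2 * θ) * S ω) := by
        refine integral_mono (hX.integrable_norm_sq_mul (wave s - wave t)) (hint.const_mul _)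
          fun ω => (mul_le_mul_of_nonneg_right (hwave ω) (hX.nonneg ω)).trans_eq ?_
        ring
    _ = (2 * √(∫ ω, |ω| ^ (2 * θ) * S ω) * |s - t| ^ θ) ^ 2 := by
        rw [integral_const_mul, mul_pow, mul_pow, Real.sq_sqrt hmoment]
        ring

lemma exists_holderWith (hX : HasSpectralDensity X S) {θ : ℝ} (hθ : 0 ≤ θ) (hθ1 : θ ≤ 1)
    (hint : Integrable fun ω => |ω| ^ (2 * θ) * S ω) :
    ∃ C : ℝ≥0, HolderWith C θ.toNNReal X := by
  refine ⟨(2 * √(∫ ω, |ω| ^ (2 * θ) * S ω)).toNNReal, fun s t => ?_⟩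
  rw [edist_dist, edist_dist, Real.coe_toNNReal θ hθ,
    ENNReal.ofReal_rpow_of_nonneg dist_nonneg hθ, ← ENNReal.ofReal, ← ENNReal.ofReal_mul
      (by positivity), dist_eq_norm, Real.dist_eq]
  exact ENNReal.ofReal_le_ofReal (hX.norm_sub_le hθ hθ1 hint s t)

protected lemma differentiable [CompleteSpace H] (hX : HasSpectralDensity X S)
    (hint : Integrable fun ω => ω ^ 2 * S ω) : Differentiable ℝ X := fun t => by
  have hcauchy : Cauchy (map (fun h => (spectralSlope X t h).1) (𝓝[≠] (0 : ℝ))) := by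
    rw [cauchy_map_iff', tendsto_uniformity_iff_dist_tendsto_zero]
    simp_rw [dist_eq_norm]
    rw [← tendsto_zero_iff_norm_tendsto_zero]
    refine hX.tendsto_zero (p := fun i : ℝ × ℝ => spectralSlope X t i.1 - spectralSlope X t i.2)
      (B := fun ω => 2 * |ω|)
      (fun i => sub_mem (spectralSlope_mem X t _) (spectralSlope_mem X t _)) (fun ω => ?_)
      (fun i ω => ?_) ?_
    · have hsub := ((tendsto_spectralSlope_snd X t ω).comp tendsto_fst).sub
        ((tendsto_spectralSlope_snd X t ω).comp (tendsto_snd (f := 𝓝[≠] (0 : ℝ))))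
      rw [sub_self] at hsub
      exact hsub
    · refine (norm_sub_le _ _).trans ?_
      rw [two_mul]
      exact add_le_add (norm_spectralSlope_snd_le X t _ ω) (norm_spectralSlope_snd_le X t _ ω)
    · simp_rw [mul_pow, sq_abs, mul_assoc]
      exact hint.const_mul _
  obtain ⟨y, hy⟩ := CompleteSpace.complete hcauchy
  exact (hasDerivAt_iff_tendsto_slope_zero.2 hy).differentiableAt

protected theorem deriv [CompleteSpace H] (hX : HasSpectralDensity X S)
    (hint : Integrable fun ω => ω ^ 2 * S ω) :
    HasSpectralDensity (deriv X) (fun ω => ω ^ 2 * S ω) := by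
  refine ⟨fun ω => mul_nonneg (sq_nonneg _) (hX.nonneg ω), hint, fun s t => ?_⟩
  have hslope (r : ℝ) : Tendsto (fun h => (spectralSlope X r h).1) (𝓝[≠] 0)
      (𝓝 (deriv X r)) :=
    hasDerivAt_iff_tendsto_slope_zero.1 (hX.differentiable hint r).hasDerivAt
  have hlim := hX.tendsto_inner (spectralSlope_mem X s) (spectralSlope_mem X t)
    (tendsto_spectralSlope_snd X s) (tendsto_spectralSlope_snd X t)
    (norm_spectralSlope_snd_le X s) (norm_spectralSlope_snd_le X t)
    (by simpa only [sq_abs] using hint)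
  rw [tendsto_nhds_unique ((Complex.continuous_ofReal.tendsto _).comp
    ((hslope s).inner (hslope t))) hlim]
  congr 1 with ω
  rw [← wave_mul_conj_wave, map_mul, map_mul, Complex.conj_I, Complex.conj_ofReal]
  push_cast
  linear_combination (-(ω : ℂ) ^ 2 * wave s ω * (starRingEnd ℂ) (wave t ω) * S ω) * Complex.I_sq

lemma integrable_sq_mul (hX : HasSpectralDensity X S) {r : ℝ} (hr : 2 ≤ r)
    (hint : Integrable fun ω => |ω| ^ r * S ω) : Integrable fun ω => ω ^ 2 * S ω := by
  refine Integrable.mono' (hX.integrable.add hint)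
    ((continuous_pow 2).aestronglyMeasurable.mul hX.integrable.aestronglyMeasurable)
    (Eventually.of_forall fun ω => ?_)
  have hpow : |ω| ^ 2 ≤ 1 + |ω| ^ r := by
    rcases le_total |ω| 1 with h | h
    · exact (pow_le_one₀ (abs_nonneg _) h).trans (le_add_of_nonneg_right (by positivity))
    · rw [← Real.rpow_two]
      exact (Real.rpow_le_rpow_of_exponent_le h hr).trans (le_add_of_nonneg_left zero_le_one)
  rw [Real.norm_of_nonneg (mul_nonneg (sq_nonneg _) (hX.nonneg ω)), Pi.add_apply, ← one_add_mul,
    ← sq_abs]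
  exact mul_le_mul_of_nonneg_right hpow (hX.nonneg ω)

theorem contDiff_and_exists_holderWith [CompleteSpace H] (hX : HasSpectralDensity X S) (n : ℕ)
    {θ : ℝ} (hθ : 0 ≤ θ) (hθ1 : θ ≤ 1) (hint : Integrable fun ω => |ω| ^ (2 * (n + θ)) * S ω) :
    ContDiff ℝ n X ∧ ∃ C : ℝ≥0, HolderWith C θ.toNNReal (iteratedDeriv n X) := by
  induction n generalizing X S with
  | zero =>
    rw [iteratedDeriv_zero]
    exact ⟨contDiff_zero.2 hX.continuous, hX.exists_holderWith hθ hθ1 (by simpa using hint)⟩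
  | succ n ih =>
    have hexp : 2 * (((n + 1 : ℕ) : ℝ) + θ) = 2 * (n + θ) + 2 := by
      push_cast
      ring
    rw [hexp] at hint
    have hsq := hX.integrable_sq_mul (le_add_of_nonneg_left (by positivity)) hint
    have hmoment : Integrable fun ω => |ω| ^ (2 * (n + θ)) * (ω ^ 2 * S ω) := by
      refine hint.congr (Eventually.of_forall fun ω => ?_)
      simp only
      rw [Real.rpow_add' (abs_nonneg ω) (by positivity), Real.rpow_two, sq_abs, mul_assoc]
    obtain ⟨hcontDiff, C, hC⟩ := ih (hX.deriv hsq) hmoment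
    refine ⟨?_, C, by rwa [iteratedDeriv_succ']⟩
    push_cast
    exact contDiff_succ_iff_deriv.2 ⟨hX.differentiable hsq, by simp, hcontDiff⟩

end HasSpectralDensity

end SpectralCurve

/-! ### Limits to the smoothness of a curve -/

section ForwardDifference

open Filter

variable {E : Type*} [NormedAddCommGroup E] [NormedSpace ℝ E] {f : ℝ → E}

lemma hasDerivAt_fwdDiff_iter (hf : Differentiable ℝ f) (h : ℝ) (k : ℕ) (t : ℝ) :
    HasDerivAt ((fwdDiff h)^[k] f) ((fwdDiff h)^[k] (deriv f) t) t := by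
  induction k generalizing t with
  | zero => exact (hf t).hasDerivAt
  | succ k ih =>
    rw [Function.iterate_succ_apply', Function.iterate_succ_apply']
    exact ((ih (t + h)).comp_add_const t h).sub (ih t)

lemma norm_fwdDiff_iter_le {n : ℕ} (hf : ContDiff ℝ n f) {a b C θ : ℝ}
    (hC : ∀ x ∈ Set.Icc a b, ∀ y ∈ Set.Icc a b,
      ‖iteratedDeriv n f x - iteratedDeriv n f y‖ ≤ C * |x - y| ^ θ)
    {h t : ℝ} (hh : 0 ≤ h) (hat : a ≤ t) (htb : t + (n + 1) * h ≤ b) :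
    ‖(fwdDiff h)^[n + 1] f t‖ ≤ C * h ^ θ * h ^ n := by
  induction n generalizing f t with
  | zero =>
    rw [Nat.cast_zero, zero_add, one_mul] at htb
    have hth : ‖f (t + h) - f t‖ ≤ C * |t + h - t| ^ θ :=
      hC (t + h) ⟨by linarith, htb⟩ t ⟨hat, by linarith⟩
    simpa [fwdDiff, abs_of_nonneg hh] using hth
  | succ n ih =>
    push_cast at hf htb
    obtain ⟨hdiff, -, hderiv⟩ := contDiff_succ_iff_deriv.1 hf
    have hbound : ∀ x ∈ Set.Ico t (t + h),
        ‖(fwdDiff h)^[n + 1] (deriv f) x‖ ≤ C * h ^ θ * h ^ n := fun x hx =>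
      ih hderiv (by simpa only [iteratedDeriv_succ'] using hC) (hat.trans hx.1)
        (by linarith [hx.2])
    rw [Function.iterate_succ_apply', fwdDiff]
    calc ‖(fwdDiff h)^[n + 1] f (t + h) - (fwdDiff h)^[n + 1] f t‖
        ≤ C * h ^ θ * h ^ n * (t + h - t) := norm_image_sub_le_of_norm_deriv_le_segment'
          (fun x _ => (hasDerivAt_fwdDiff_iter hdiff h (n + 1) x).hasDerivWithinAt) hbound
          (t + h) ⟨by linarith, le_rfl⟩
      _ = C * h ^ θ * h ^ (n + 1) := by ring

lemma eventually_norm_fwdDiff_iter_le {n : ℕ} (hf : ContDiff ℝ n f) {C θ : ℝ≥0} {N : Set ℝ}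
    {t : ℝ} (hN : N ∈ 𝓝 t) (hC : HolderOnWith C θ (iteratedDeriv n f) N) :
    ∀ᶠ h in 𝓝[>] (0 : ℝ), ‖(fwdDiff h)^[n + 1] f t‖ ≤ C * h ^ (θ : ℝ) * h ^ n := by
  obtain ⟨r, hr, hball⟩ := Metric.nhds_basis_closedBall.mem_iff.1 hN
  rw [Real.closedBall_eq_Icc] at hball
  have hcont : Continuous fun h : ℝ => t + (n + 1) * h := by fun_prop
  have hsmall : ∀ᶠ h in 𝓝[>] (0 : ℝ), t + (n + 1) * h ≤ t + r :=
    ((hcont.tendsto 0).mono_left nhdsWithin_le_nhds).eventually_le_const (by simpa using hr)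
  filter_upwards [hsmall, self_mem_nhdsWithin] with h hhr hh
  refine norm_fwdDiff_iter_le hf (fun x hx y hy => ?_) (Set.mem_Ioi.1 hh).le
    (sub_le_self t hr.le) hhr
  rw [← dist_eq_norm, ← Real.dist_eq]
  exact hC.dist_le (hball hx) (hball hy)

end ForwardDifference

section SmoothnessBound

open Filter

lemma fwdDiff_iter_spectralGraph_fst {E : Type*} [AddCommGroup E] (X : ℝ → E) (h : ℝ) (k : ℕ)
    (t : ℝ) : ((fwdDiff h)^[k] (spectralGraph X) t).1 = (fwdDiff h)^[k] X t := by
  induction k generalizing t with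
  | zero => rfl
  | succ k ih =>
    rw [Function.iterate_succ_apply', Function.iterate_succ_apply', fwdDiff, fwdDiff,
      Prod.fst_sub, ih, ih]

lemma fwdDiff_iter_spectralGraph_snd {E : Type*} [AddCommGroup E] (X : ℝ → E) (h : ℝ) (k : ℕ)
    (t ω : ℝ) : ((fwdDiff h)^[k] (spectralGraph X) t).2 ω = wave t ω * (wave h ω - 1) ^ k := by
  induction k generalizing t with
  | zero => rw [pow_zero, mul_one, Function.iterate_zero_apply, spectralGraph]
  | succ k ih =>
    rw [Function.iterate_succ_apply', fwdDiff, Prod.snd_sub, BoundedContinuousFunction.sub_apply,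
      ih, ih, wave_add]
    ring

variable {H : Type*} [NormedAddCommGroup H] [InnerProductSpace ℝ H] {X : ℝ → H} {S : ℝ → ℝ}

lemma fwdDiff_iter_spectralGraph_mem (X : ℝ → H) (h : ℝ) (k : ℕ) (t : ℝ) :
    (fwdDiff h)^[k] (spectralGraph X) t ∈ spectralSpan X := by
  induction k generalizing t with
  | zero => exact spectralGraph_mem X t
  | succ k ih =>
    rw [Function.iterate_succ_apply']
    exact sub_mem (ih _) (ih _)

lemma HasSpectralDensity.norm_fwdDiff_iter_sq (hX : HasSpectralDensity X S) (h : ℝ) (k : ℕ)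
    (t : ℝ) : ‖(fwdDiff h)^[k] X t‖ ^ 2 = ∫ ω, (‖wave h ω - 1‖ ^ k) ^ 2 * S ω := by
  rw [← fwdDiff_iter_spectralGraph_fst,
    hX.norm_sq_eq_integral (fwdDiff_iter_spectralGraph_mem X h k t)]
  simp_rw [fwdDiff_iter_spectralGraph_snd, norm_mul, norm_wave, one_mul, norm_pow]

lemma HasSpectralDensity.integrable_norm_wave_sub_one_pow_sq_mul (hX : HasSpectralDensity X S)
    (h : ℝ) (k : ℕ) : Integrable fun ω => (‖wave h ω - 1‖ ^ k) ^ 2 * S ω := by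
  have hint := hX.integrable_norm_sq_mul ((fwdDiff h)^[k] (spectralGraph X) 0).2
  simpa only [fwdDiff_iter_spectralGraph_snd, norm_mul, norm_wave, one_mul, norm_pow] using hint

lemma le_norm_wave_sub_one_pow_sq_mul {m c h ω : ℝ} (hc : 0 ≤ c) (hm : 0 ≤ m) (hh : 0 < h)
    (hω : ω ∈ Set.Icc (2 * h)⁻¹ h⁻¹) (hS : c * ω ^ (-(2 * m)) ≤ S ω) (k : ℕ) :
    (Real.pi⁻¹ ^ k) ^ 2 * (c * h ^ (2 * m)) ≤ (‖wave h ω - 1‖ ^ k) ^ 2 * S ω := by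
  have hω0 : 0 < ω := lt_of_lt_of_le (by positivity) hω.1
  have hωh : 1 / 2 ≤ ω * h := by
    rw [← div_le_iff₀ hh]
    exact (by field_simp : 1 / 2 / h = (2 * h)⁻¹).trans_le hω.1
  have hωh1 : ω * h ≤ 1 := by
    rw [← le_div_iff₀ hh, one_div]
    exact hω.2
  have hpow : h ^ (2 * m) ≤ ω ^ (-(2 * m)) := by
    rw [Real.rpow_neg hω0.le, ← Real.inv_rpow hω0.le]
    exact Real.rpow_le_rpow hh.le ((le_inv_comm₀ hω0 hh).1 hω.2) (by positivity)
  refine mul_le_mul ?_ ((mul_le_mul_of_nonneg_left hpow hc).trans hS) (by positivity)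
    (by positivity)
  gcongr
  exact inv_pi_le_norm_wave_sub_one hωh hωh1

lemma HasSpectralDensity.eventually_le_norm_fwdDiff_iter_sq (hX : HasSpectralDensity X S)
    {m c : ℝ} (hc : 0 ≤ c) (hm : 0 ≤ m) (hS : ∀ᶠ ω in atTop, c * ω ^ (-(2 * m)) ≤ S ω) (k : ℕ)
    (t : ℝ) : ∀ᶠ h in 𝓝[>] (0 : ℝ),
      (Real.pi⁻¹ ^ k) ^ 2 * c / 2 * h ^ (2 * m - 1) ≤ ‖(fwdDiff h)^[k] X t‖ ^ 2 := by
  obtain ⟨ω₀, hω₀⟩ := eventually_atTop.1 hS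
  have hlarge : ∀ᶠ h in 𝓝[>] (0 : ℝ), ω₀ ≤ 2⁻¹ * h⁻¹ :=
    (tendsto_inv_nhdsGT_zero.const_mul_atTop (by positivity)).eventually_ge_atTop ω₀
  filter_upwards [hlarge, self_mem_nhdsWithin] with h hωh hh
  rw [Set.mem_Ioi] at hh
  rw [← mul_inv] at hωh
  have hint := hX.integrable_norm_wave_sub_one_pow_sq_mul h k
  have hIcc : (2 * h)⁻¹ ≤ h⁻¹ := by
    gcongr
    linarith
  calc (Real.pi⁻¹ ^ k) ^ 2 * c / 2 * h ^ (2 * m - 1)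
      = ∫ _ in Set.Icc (2 * h)⁻¹ h⁻¹, (Real.pi⁻¹ ^ k) ^ 2 * (c * h ^ (2 * m)) := by
        rw [setIntegral_const, Real.volume_real_Icc_of_le hIcc, smul_eq_mul, Real.rpow_sub hh,
          Real.rpow_one]
        field_simp
        ring
    _ ≤ ∫ ω in Set.Icc (2 * h)⁻¹ h⁻¹, (‖wave h ω - 1‖ ^ k) ^ 2 * S ω :=
        setIntegral_mono_on (continuousOn_const.integrableOn_compact isCompact_Icc)
          hint.integrableOn measurableSet_Icc fun ω hω =>
            le_norm_wave_sub_one_pow_sq_mul hc hm hh hω (hω₀ ω (hωh.trans hω.1)) k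
    _ ≤ ∫ ω, (‖wave h ω - 1‖ ^ k) ^ 2 * S ω := setIntegral_le_integral hint
        (Eventually.of_forall fun ω => mul_nonneg (sq_nonneg _) (hX.nonneg ω))
    _ = ‖(fwdDiff h)^[k] X t‖ ^ 2 := (hX.norm_fwdDiff_iter_sq h k t).symm

lemma le_of_eventually_mul_rpow_le {K D p q : ℝ} (hK : 0 < K)
    (hle : ∀ᶠ h in 𝓝[>] (0 : ℝ), K * h ^ p ≤ D * h ^ q) : q ≤ p := by
  by_contra! hpq
  have hlim : Tendsto (fun h : ℝ => D * h ^ (q - p)) (𝓝[>] 0) (𝓝 0) := by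
    have hcont : Continuous fun h : ℝ => D * h ^ (q - p) :=
      continuous_const.mul (Real.continuous_rpow_const (sub_pos.2 hpq).le)
    have hzero := (hcont.tendsto 0).mono_left (nhdsWithin_le_nhds (s := Set.Ioi 0))
    rwa [Real.zero_rpow (sub_pos.2 hpq).ne', mul_zero] at hzero
  refine hK.not_ge (ge_of_tendsto hlim ?_)
  filter_upwards [hle, self_mem_nhdsWithin] with h hh hh0
  rw [Set.mem_Ioi] at hh0
  rwa [Real.rpow_sub hh0, mul_div_assoc', le_div_iff₀ (by positivity)]

theorem HasSpectralDensity.add_le_of_holderOnWith (hX : HasSpectralDensity X S) {m c : ℝ}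
    (hc : 0 < c) (hm : 0 ≤ m) (hS : ∀ᶠ ω in atTop, c * ω ^ (-(2 * m)) ≤ S ω) {n : ℕ}
    (hcontDiff : ContDiff ℝ n X) {C θ : ℝ≥0} {N : Set ℝ} {t : ℝ} (hN : N ∈ 𝓝 t)
    (hC : HolderOnWith C θ (iteratedDeriv n X) N) : n + θ ≤ m - 1 / 2 := by
  have hle : ∀ᶠ h in 𝓝[>] (0 : ℝ),
      (Real.pi⁻¹ ^ (n + 1)) ^ 2 * c / 2 * h ^ (2 * m - 1) ≤ C ^ 2 * h ^ (2 * (n + θ : ℝ)) := by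
    filter_upwards [hX.eventually_le_norm_fwdDiff_iter_sq hc.le hm hS (n + 1) t,
      eventually_norm_fwdDiff_iter_le hcontDiff hN hC, self_mem_nhdsWithin] with h hlower hupper hh
    calc (Real.pi⁻¹ ^ (n + 1)) ^ 2 * c / 2 * h ^ (2 * m - 1)
        ≤ (C * h ^ (θ : ℝ) * h ^ n) ^ 2 :=
          hlower.trans (pow_le_pow_left₀ (norm_nonneg _) hupper 2)
      _ = C ^ 2 * h ^ (2 * (n + θ : ℝ)) := by
          rw [mul_comm 2, Real.rpow_mul (Set.mem_Ioi.1 hh).le, Real.rpow_two,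
            Real.rpow_add (Set.mem_Ioi.1 hh), Real.rpow_natCast]
          ring
  linarith [le_of_eventually_mul_rpow_le (by positivity) hle]

end SmoothnessBound

/-! ### Mean-square smoothness from the temporal spectrum -/

section Decay

open Filter

variable {a b κ : ℝ}

lemma rpow_mul_sq {κ x : ℝ} (hκ : 0 ≤ κ) (hx : 0 ≤ x) (p : ℝ) :
    (κ * x ^ 2) ^ p = κ ^ p * x ^ (2 * p) := by
  rw [Real.mul_rpow hκ (sq_nonneg x), ← Real.rpow_two, ← Real.rpow_mul hx]

lemma exists_eventually_le_negEulerIntegral_mul_sq (a : ℝ) (hb : 0 < b) (hκ : 0 < κ) :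
    ∃ c, 0 < c ∧
      ∀ᶠ ω in atTop, c * ω ^ (-(2 * min a b)) ≤ negEulerIntegral a b (κ * ω ^ 2) := by
  obtain ⟨c, hc, hle⟩ := exists_pos_mul_rpow_neg_min_le_negEulerIntegral a hb
  refine ⟨c * κ ^ (-min a b), by positivity, ?_⟩
  have hlarge : Tendsto (fun ω : ℝ => κ * ω ^ 2) atTop atTop :=
    (tendsto_pow_atTop two_ne_zero).const_mul_atTop hκ
  filter_upwards [hlarge.eventually_ge_atTop 1, eventually_ge_atTop 0] with ω hω hω0
  calc c * κ ^ (-min a b) * ω ^ (-(2 * min a b)) = c * (κ * ω ^ 2) ^ (-min a b) := by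
        rw [rpow_mul_sq hκ.le hω0, mul_neg, mul_assoc]
    _ ≤ negEulerIntegral a b (κ * ω ^ 2) := hle _ hω

lemma half_lt_min_of_integrable_negEulerIntegral (hb : 0 < b) (hκ : 0 < κ)
    (hint : Integrable fun ω : ℝ => negEulerIntegral a b (κ * ω ^ 2)) : 1 / 2 < min a b := by
  obtain ⟨c, hc, hle⟩ := exists_eventually_le_negEulerIntegral_mul_sq a hb hκ
  have hbigO : (fun ω : ℝ => ω ^ (-(2 * min a b))) =O[atTop]
      fun ω => negEulerIntegral a b (κ * ω ^ 2) := by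
    refine Asymptotics.IsBigO.of_bound c⁻¹ ?_
    filter_upwards [hle, eventually_ge_atTop 0] with ω hω hω0
    rw [Real.norm_of_nonneg (by positivity), le_inv_mul_iff₀ hc]
    exact hω.trans (Real.le_norm_self _)
  have hpow := integrableAtFilter_rpow_atTop_iff.1 (hbigO.integrableAtFilter
    (Measurable.aestronglyMeasurable (by fun_prop)).stronglyMeasurableAtFilter
    (hint.integrableAtFilter _))
  linarith

lemma integrable_rpow_mul_negEulerIntegral (hκ : 0 < κ)
    (hint : Integrable fun ω : ℝ => negEulerIntegral a b (κ * ω ^ 2)) {ν : ℝ} (hν : 0 ≤ ν)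
    (hνab : ν < min a b - 1 / 2) :
    Integrable fun ω : ℝ => |ω| ^ (2 * ν) * negEulerIntegral a b (κ * ω ^ 2) := by
  obtain ⟨p, hνp, hpab⟩ := exists_between (lt_sub_iff_add_lt.1 hνab)
  have hcont : Continuous fun ω : ℝ => |ω| ^ (2 * ν) :=
    continuous_abs.rpow_const fun _ => Or.inr (by positivity)
  have hbigO : (fun ω : ℝ => |ω| ^ (2 * ν) * negEulerIntegral a b (κ * ω ^ 2)) =O[atTop]
      fun ω => ω ^ (2 * ν - 2 * p) := by
    refine Asymptotics.IsBigO.of_bound ((b - p)⁻¹ * κ ^ (-p)) ?_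
    filter_upwards [eventually_gt_atTop 0] with ω hω
    have hle := negEulerIntegral_le (by linarith) (hpab.le.trans (min_le_left a b))
      (hpab.trans_le (min_le_right a b)) (mul_pos hκ (pow_pos hω 2))
    rw [rpow_mul_sq hκ.le hω.le, mul_neg] at hle
    rw [norm_mul, abs_of_pos hω, Real.norm_of_nonneg (by positivity),
      Real.norm_of_nonneg (negEulerIntegral_nonneg a b (by positivity)),
      Real.norm_of_nonneg (by positivity)]
    calc ω ^ (2 * ν) * negEulerIntegral a b (κ * ω ^ 2)
        ≤ ω ^ (2 * ν) * ((b - p)⁻¹ * (κ ^ (-p) * ω ^ (-(2 * p)))) := by gcongr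
      _ = (b - p)⁻¹ * κ ^ (-p) * ω ^ (2 * ν - 2 * p) := by
        rw [sub_eq_add_neg (2 * ν), Real.rpow_add hω]
        ring
  refine LocallyIntegrable.integrable_of_isBigO_atTop_of_norm_isNegInvariant ?_
    (Eventually.of_forall fun ω => ?_) hbigO (integrableAtFilter_rpow_atTop_iff.2 (by linarith))
  · rw [← locallyIntegrableOn_univ]
    exact hint.locallyIntegrable.locallyIntegrableOn _ |>.continuousOn_mul hcont.continuousOn
      isOpen_univ.isLocallyClosed
  · simp only [Function.comp_apply, abs_neg, neg_sq]

end Decay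

section ProcessSmoothness

variable {Ω : Type*} [MeasurableSpace Ω] {P : Measure Ω} {X : ℝ → Ω → ℝ}

lemma IsProcessSpectrum.hasSpectralDensity {S : ℝ → ℝ} (hS : IsProcessSpectrum P X S)
    (hX : ∀ t, MemLp (X t) 2 P) (hX0 : ∀ t, ∫ w, X t w ∂P = 0) :
    HasSpectralDensity (fun t => (hX t).toLp (X t)) S where
  nonneg := hS.nonneg
  integrable := hS.integrable
  inner_eq s t := by
    rw [← covariance_eq_inner (hX s).coeFn_toLp.symm (hX t).coeFn_toLp.symm (hX0 s) (hX0 t),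
      hS.covariance_eq]
    simp_rw [wave_apply]

theorem IsProcessSpectrum.hasMSSmoothness {a b κ C : ℝ} (hb : 0 < b) (hκ : 0 < κ) (hC : 0 < C)
    (hS : IsProcessSpectrum P X fun ω => C * negEulerIntegral a b (κ * ω ^ 2))
    (hX : ∀ t, MemLp (X t) 2 P) (hX0 : ∀ t, ∫ w, X t w ∂P = 0) :
    HasMSSmoothness P X (min a b - 1 / 2) := by
  have hcurve := hS.hasSpectralDensity hX hX0
  have hint := (integrable_const_mul_iff (IsUnit.mk0 C hC.ne') _).1 hS.integrable
  have hmin := half_lt_min_of_integrable_negEulerIntegral hb hκ hint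
  refine ⟨by linarith, fun ν hν hlt => ⟨hX, ?_⟩, fun ν hlt hdiff => ?_⟩
  · have hfract : 0 ≤ ν - ⌊ν⌋₊ := sub_nonneg.2 (Nat.floor_le hν)
    have hmoment : Integrable fun ω =>
        |ω| ^ (2 * (⌊ν⌋₊ + (ν - ⌊ν⌋₊))) * (C * negEulerIntegral a b (κ * ω ^ 2)) := by
      simp_rw [add_sub_cancel, mul_left_comm _ C]
      exact (integrable_rpow_mul_negEulerIntegral hκ hint hν hlt).const_mul C
    obtain ⟨hcontDiff, K, hK⟩ := hcurve.contDiff_and_exists_holderWith ⌊ν⌋₊ hfract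
      (by linarith [Nat.lt_floor_add_one ν]) hmoment
    exact ⟨hcontDiff, fun t => ⟨K, Set.univ, Filter.univ_mem, hK.holderOnWith _⟩⟩
  · obtain ⟨_, hcontDiff, hHolder⟩ := hdiff
    obtain ⟨K, N, hN, hK⟩ := hHolder 0
    obtain ⟨c, hc, hle⟩ := exists_eventually_le_negEulerIntegral_mul_sq a hb hκ
    have hdecay : ∀ᶠ ω in Filter.atTop,
        C * c * ω ^ (-(2 * min a b)) ≤ C * negEulerIntegral a b (κ * ω ^ 2) :=
      hle.mono fun ω hω => by
        rw [mul_assoc]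
        exact mul_le_mul_of_nonneg_left hω hC.le
    have hfract : 0 ≤ ν - ⌊ν⌋₊ := sub_nonneg.2 (Nat.floor_le (by linarith))
    have hbound :=
      hcurve.add_le_of_holderOnWith (mul_pos hC hc) (by linarith) hdecay hcontDiff hN hK
    rw [Real.coe_toNNReal _ hfract, add_sub_cancel] at hbound
    exact hlt.not_ge hbound

end ProcessSmoothness

end DEMF

end

theorem proposition2_general {Ω : Type*} [MeasurableSpace Ω] (P : Measure Ω)
    [IsProbabilityMeasure P]
    (αt αs αe γt γs γe α νs : ℝ) (hαs : 0 < αs) (hγt : γt ≠ 0) (hγs : 0 < γs) (hγe : γe ≠ 0)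
    (hα : α = αe + αs * (αt - 1 / 2)) (hα1 : 1 < α) (hνs : νs = α - 1)
    (W u : 𝓢(DEMF.SpaceTime, ℝ) → Ω → ℝ)
    (hW : DEMF.IsNoise αe γs γe P W)
    (hu : DEMF.IsSolution αt αs γt γs P W u) :
    ∃ (St : ℝ → ℝ) (C : ℝ), 0 < C ∧
      (∀ ωt : ℝ, (St ωt : ℂ) = (C : ℂ) * DEMF.gaussHypergeometric
        (αt : ℂ) (((αe - 1) / αs + αt : ℝ) : ℂ) (((αe - 1) / αs + αt + 1 : ℝ) : ℂ)
        ((-(γt ^ 2 * γs ^ (-2 * αs) * ωt ^ 2) : ℝ) : ℂ)) ∧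
      DEMF.IsMarginalTemporalSpectrum P u St ∧
      ∀ U : DEMF.Space → ℝ → Ω → ℝ, DEMF.IsPointwiseVersion P u U → ∀ s : DEMF.Space,
        DEMF.IsProcessSpectrum P (U s) St ∧
        DEMF.HasMSSmoothness P (U s) (min (αt - 1 / 2) (νs / αs)) := by
  obtain ⟨b, hb⟩ : ∃ b, b = (αe - 1) / αs + αt := ⟨_, rfl⟩
  have hνb : νs / αs = b - 1 / 2 := by
    rw [hνs, hα, hb]
    field_simp
    ring
  have hb0 : 0 < b := by linarith [div_pos (show 0 < νs by linarith) hαs]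
  obtain ⟨C, hC, hSt⟩ := DEMF.exists_marginalSpectrum_eq_negEulerIntegral hαs hγs hγe γt hb
  have hS := hu.isSpectrum hαs.le hγs hW
  have hmean := hu.integral_eq_zero hαs.le hγs hW
  refine ⟨DEMF.marginalSpectrum αt αs αe γt γs γe, C / b, by positivity, fun ωt => ?_,
    ⟨_, hS, fun ωt => ⟨DEMF.integrable_fieldSpectrum_slice hαs hγs γt γe ωt hb hb0, rfl⟩⟩,
    fun U hU s => ?_⟩
  · rw [← hb, DEMF.gaussHypergeometric_neg_ofReal αt hb0 (by positivity), hSt,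
      ← Complex.ofReal_mul, ← mul_assoc, div_mul_cancel₀ _ hb0.ne']
  · have hP : DEMF.IsProcessSpectrum P (U s) (DEMF.marginalSpectrum αt αs αe γt γs γe) :=
      hU.isProcessSpectrum hmean hS s
    refine ⟨hP, ?_⟩
    rw [hνb, min_sub_sub_right]
    rw [funext hSt] at hP
    exact hP.hasMSSmoothness hb0 (by positivity) hC (hU.memLp s) (hU.integral_eq_zero hmean s)

theorem proposition2 {Ω : Type*} [MeasurableSpace Ω] (P : Measure Ω) [IsProbabilityMeasure P]
    (αt αs αe γt γs γe α νs : ℝ)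
    (hαt : 0 ≤ αt) (hαs : 0 < αs) (hαe : 0 ≤ αe)
    (hγt : 0 < γt) (hγs : 0 < γs) (hγe : 0 < γe)
    (hα : α = αe + αs * (αt - 1 / 2)) (hα1 : 1 < α) (hνs : νs = α - 1)
    (W u : 𝓢(DEMF.SpaceTime, ℝ) → Ω → ℝ)
    (hW : DEMF.IsNoise αe γs γe P W)
    (hu : DEMF.IsSolution αt αs γt γs P W u) :
    ∃ (St : ℝ → ℝ) (C : ℝ), 0 < C ∧
      (∀ ωt : ℝ, (St ωt : ℂ) = (C : ℂ) * DEMF.gaussHypergeometric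
        (αt : ℂ) (((αe - 1) / αs + αt : ℝ) : ℂ) (((αe - 1) / αs + αt + 1 : ℝ) : ℂ)
        ((-(γt ^ 2 * γs ^ (-2 * αs) * ωt ^ 2) : ℝ) : ℂ)) ∧
      DEMF.IsMarginalTemporalSpectrum P u St ∧
      ∀ U : DEMF.Space → ℝ → Ω → ℝ, DEMF.IsPointwiseVersion P u U → ∀ s : DEMF.Space,
        DEMF.IsProcessSpectrum P (U s) St ∧
        DEMF.HasMSSmoothness P (U s) (min (αt - 1 / 2) (νs / αs)) := by
  exact proposition2_general P αt αs αe γt γs γe α νs hαs hγt.ne' hγs hγe.ne' hα hα1 hνs W u hW hu
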